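/- A multimarket oligopoly consists of finite sets $N$ of $n$ firms and $E$ of $m$ markets, a set $E_i\subseteq E$ of accessible markets for every firm $i$, non-increasing, concave, differentiable price functions $p_{i,e}:\mathbb R\to\mathbb R$ for $i\in N$, $e\in E_i$, and production costs $C_i(t)=c_it^2$ with $c_i\ge 0$. A strategy of firm $i$ is a vector $x_i\in\mathbb R_{\ge 0}^{E_i}$, and the utility of firm $i$ in a profile $x$ is $$u_i(x)=\sum_{e\in E_i}p_{i,e}(x_e)\,x_{i,e}-C_i\Big(\sum_{e\in E_i}x_{i,e}\Big),\qquad x_e=\sum_{j:\,e\in E_j}x_{j,e}.$$ A profile $x$ is an $\epsilon$-approximate equilibrium if $u_i(y_i,x_{-i})\le u_i(x)+\epsilon$ for every firm $i$ and every strategy $y_i$ of firm $i$. Assume that $\max\{t\mid p_{i,e}(t)=0\}$ exists and is non-negative for all $i\in N$, $e\in E_i$, and put $d_i=\sum_{e\in E_i}\max\{t\mid p_{i,e}(t)=0\}$. Theorem. There is an algorithm that, given a multimarket oligopoly (the numbers $n,m$, the sets $E_i$, the coefficients $c_i$, and oracle access to the values of the price functions), a number $L>0$ such that all price functions $p_{i,e}$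 are Lipschitz continuous with constant $L$, and $\epsilon>0$, computes an $\epsilon$-approximate equilibrium in pseudo-polynomial time: the number of steps is bounded by a fixed polynomial in $n$, $m$, $L$, $\max_{i\in N}d_i$ and $1/\epsilon$. Here an algorithm is a program for a random access machine with exact real arithmetic, without rounding and without real constants, and every arithmetic operation, comparison, memory access and evaluation of a price function counts as one step. -/

import Mathlib

open scoped NNReal

/-! ## Multimarket Cournot oligopolies -/

/-- A multimarket oligopoly with `n` firms and `m` markets. Firm `i` has access to the markets in
`access i`, faces there the firm-specific price functions `price i e`, and has the production costs
`t ↦ cost i * t ^ 2`. The values `price i e` for `e ∉ access i` play no role. -/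
structure Oligopoly (n m : ℕ) where
  access : Fin n → Finset (Fin m)
  price : Fin n → Fin m → ℝ → ℝ
  cost : Fin n → ℝ
  price_antitone : ∀ i, ∀ e ∈ access i, Antitone (price i e)
  price_differentiable : ∀ i, ∀ e ∈ access i, Differentiable ℝ (price i e)
  price_concave : ∀ i, ∀ e ∈ access i, ConcaveOn ℝ Set.univ (price i e)
  cost_nonneg : ∀ i, 0 ≤ cost i

namespace Oligopoly

variable {n m : ℕ} (M : Oligopoly n m)

/-- The strategies of firm `i`: a nonnegative quantity for every market in `access i`, written as a
vector over all markets that is zero outside `access i`. -/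
def strategies (i : Fin n) : Set (Fin m → ℝ) :=
  {y | (∀ e, 0 ≤ y e) ∧ ∀ e ∉ M.access i, y e = 0}

/-- The utility of firm `i` in the profile `x`: revenue minus production costs. -/
noncomputable def utility (i : Fin n) (x : Fin n → Fin m → ℝ) : ℝ :=
  ∑ e ∈ M.access i, M.price i e (∑ j, x j e) * x i e
    - M.cost i * (∑ e ∈ M.access i, x i e) ^ 2

/-- `x` is a strategy profile in which no firm can gain more than `ε` by deviating alone. -/
def IsApproxEquilibrium (ε : ℝ) (x : Fin n → Fin m → ℝ) : Prop :=
  (∀ i, x i ∈ M.strategies i) ∧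
    ∀ i, ∀ y ∈ M.strategies i, M.utility i (Function.update x i y) ≤ M.utility i x + ε

/-- The bound `d_i = ∑_{e ∈ E_i} max {t | p_{i,e}(t) = 0}` on the production of firm `i`
(used only where these maxima exist, so that `sSup` is the maximum). -/
noncomputable def demand (i : Fin n) : ℝ :=
  ∑ e ∈ M.access i, sSup {t : ℝ | M.price i e t = 0}

/-- `max_i d_i` (and `0` if there are no firms). -/
noncomputable def maxDemand : ℝ := ⨆ i, M.demand i

end Oligopoly

/-! ## Random access machines over the reals with an evaluation oracle

Programs of a structured language that works on arrays of natural numbers (for counting and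
addressing) and on arrays of real numbers. The elementary operations are addition and truncated
subtraction of naturals, the four field operations on reals, the embedding of a natural number in
the reals, memory accesses, comparisons, and queries to an oracle that evaluates a family of real
functions. There is no rounding, and a program contains no constants except natural numbers. Every
elementary operation costs one step. -/

namespace RealRAM

/-- The memory. Arrays are named by natural numbers and have two indices. -/
structure Store where
  nats : ℕ → ℕ → ℕ → ℕ
  reals : ℕ → ℕ → ℕ → ℝ

/-- Overwriting one cell of an array. -/
def setCell {α : Type} (f : ℕ → ℕ → ℕ → α) (a i j : ℕ) (v : α) : ℕ → ℕ → ℕ → α :=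
  fun a' i' j' => if a' = a ∧ i' = i ∧ j' = j then v else f a' i' j'

/-- Expressions for natural numbers. -/
inductive NatExp : Type
  | const (c : ℕ)
  | cell (a : ℕ) (i j : NatExp)
  | add (u v : NatExp)
  | sub (u v : NatExp)

namespace NatExp

def eval (s : Store) : NatExp → ℕ
  | const c => c
  | cell a i j => s.nats a (i.eval s) (j.eval s)
  | add u v => u.eval s + v.eval s
  | sub u v => u.eval s - v.eval s

/-- The number of steps of an evaluation. -/
def steps : NatExp → ℕ
  | const _ => 1
  | cell _ i j => i.steps + j.steps + 1
  | add u v => u.steps + v.steps + 1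
  | sub u v => u.steps + v.steps + 1

end NatExp

/-- Expressions for real numbers; `query i e t` asks the oracle for the value at `t` of its
function number `(i, e)`. -/
inductive RealExp : Type
  | cast (u : NatExp)
  | cell (a : ℕ) (i j : NatExp)
  | add (u v : RealExp)
  | sub (u v : RealExp)
  | mul (u v : RealExp)
  | div (u v : RealExp)
  | query (i e : NatExp) (t : RealExp)

namespace RealExp

noncomputable def eval (oracle : ℕ → ℕ → ℝ → ℝ) (s : Store) : RealExp → ℝ
  | cast u => (u.eval s : ℝ)
  | cell a i j => s.reals a (i.eval s) (j.eval s)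
  | add u v => u.eval oracle s + v.eval oracle s
  | sub u v => u.eval oracle s - v.eval oracle s
  | mul u v => u.eval oracle s * v.eval oracle s
  | div u v => u.eval oracle s / v.eval oracle s
  | query i e t => oracle (i.eval s) (e.eval s) (t.eval oracle s)

/-- The number of steps of an evaluation. -/
def steps : RealExp → ℕ
  | cast u => u.steps + 1
  | cell _ i j => i.steps + j.steps + 1
  | add u v => u.steps + v.steps + 1
  | sub u v => u.steps + v.steps + 1
  | mul u v => u.steps + v.steps + 1
  | div u v => u.steps + v.steps + 1
  | query i e t => i.steps + e.steps + t.steps + 1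

end RealExp

/-- Tests. -/
inductive Test : Type
  | natLe (u v : NatExp)
  | realLe (u v : RealExp)
  | not (b : Test)
  | and (b c : Test)

namespace Test

def Holds (oracle : ℕ → ℕ → ℝ → ℝ) (s : Store) : Test → Prop
  | natLe u v => u.eval s ≤ v.eval s
  | realLe u v => u.eval oracle s ≤ v.eval oracle s
  | not b => ¬ b.Holds oracle s
  | and b c => b.Holds oracle s ∧ c.Holds oracle s

/-- The number of steps of a test. -/
def steps : Test → ℕ
  | natLe u v => u.steps + v.steps + 1
  | realLe u v => u.steps + v.steps + 1
  | not b => b.steps + 1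
  | and b c => b.steps + c.steps + 1

end Test

/-- Programs: assignments to a cell of an array, composition, branching, and while loops. -/
inductive Program : Type
  | skip
  | setNat (a : ℕ) (i j : NatExp) (v : NatExp)
  | setReal (a : ℕ) (i j : NatExp) (v : RealExp)
  | seq (p q : Program)
  | branch (b : Test) (p q : Program)
  | loop (b : Test) (p : Program)

/-- `Runs oracle p s s' t`: started in the store `s`, the program `p` halts after exactly `t` steps
in the store `s'`. -/
inductive Runs (oracle : ℕ → ℕ → ℝ → ℝ) : Program → Store → Store → ℕ → Prop
  | skip (s : Store) : Runs oracle .skip s s 1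
  | setNat (s : Store) (a : ℕ) (i j v : NatExp) :
      Runs oracle (.setNat a i j v) s
        { s with nats := setCell s.nats a (i.eval s) (j.eval s) (v.eval s) }
        (i.steps + j.steps + v.steps + 1)
  | setReal (s : Store) (a : ℕ) (i j : NatExp) (v : RealExp) :
      Runs oracle (.setReal a i j v) s
        { s with reals := setCell s.reals a (i.eval s) (j.eval s) (v.eval oracle s) }
        (i.steps + j.steps + v.steps + 1)
  | seq {p q : Program} {s s' s'' : Store} {t t' : ℕ} :
      Runs oracle p s s' t → Runs oracle q s' s'' t' →
        Runs oracle (.seq p q) s s'' (t + t')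
  | branchTrue {b : Test} {p q : Program} {s s' : Store} {t : ℕ} :
      b.Holds oracle s → Runs oracle p s s' t →
        Runs oracle (.branch b p q) s s' (b.steps + t)
  | branchFalse {b : Test} {p q : Program} {s s' : Store} {t : ℕ} :
      ¬ b.Holds oracle s → Runs oracle q s s' t →
        Runs oracle (.branch b p q) s s' (b.steps + t)
  | loopDone {b : Test} {p : Program} {s : Store} :
      ¬ b.Holds oracle s → Runs oracle (.loop b p) s s b.steps
  | loopStep {b : Test} {p : Program} {s s' s'' : Store} {t t' : ℕ} :
      b.Holds oracle s → Runs oracle p s s' t → Runs oracle (.loop b p) s' s'' t' →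
        Runs oracle (.loop b p) s s'' (b.steps + t + t')

/-- The machine is deterministic: a halting run fixes the final store and the number of steps. -/
theorem Runs.deterministic {oracle : ℕ → ℕ → ℝ → ℝ} {p : Program} {s s₁ s₂ : Store} {t₁ t₂ : ℕ}
    (run₁ : Runs oracle p s s₁ t₁) (run₂ : Runs oracle p s s₂ t₂) : s₁ = s₂ ∧ t₁ = t₂ := by
  induction run₁ generalizing s₂ t₂ with
  | skip | setNat | setReal => cases run₂; exact ⟨rfl, rfl⟩
  | seq _ _ ih ih' =>
    cases run₂ with
    | seq h h' =>
      obtain ⟨rfl, rfl⟩ := ih h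
      obtain ⟨rfl, rfl⟩ := ih' h'
      exact ⟨rfl, rfl⟩
  | branchTrue hb _ ih =>
    cases run₂ with
    | branchTrue _ h => obtain ⟨rfl, rfl⟩ := ih h; exact ⟨rfl, rfl⟩
    | branchFalse hb' _ => exact absurd hb hb'
  | branchFalse hb _ ih =>
    cases run₂ with
    | branchTrue hb' _ => exact absurd hb' hb
    | branchFalse _ h => obtain ⟨rfl, rfl⟩ := ih h; exact ⟨rfl, rfl⟩
  | loopDone hb =>
    cases run₂ with
    | loopDone _ => exact ⟨rfl, rfl⟩
    | loopStep hb' _ _ => exact absurd hb' hb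
  | loopStep hb _ _ ih ih' =>
    cases run₂ with
    | loopDone hb' => exact absurd hb hb'
    | loopStep _ h h' =>
      obtain ⟨rfl, rfl⟩ := ih h
      obtain ⟨rfl, rfl⟩ := ih' h'
      exact ⟨rfl, rfl⟩

end RealRAM

/-! ## Oligopolies as inputs -/

namespace Oligopoly

variable {n m : ℕ} (M : Oligopoly n m)

/-- The oracle that evaluates the price functions (and answers `0` to meaningless queries). -/
noncomputable def priceOracle (i e : ℕ) (t : ℝ) : ℝ :=
  if h : i < n ∧ e < m then
    if (⟨e, h.2⟩ : Fin m) ∈ M.access ⟨i, h.1⟩ then M.price ⟨i, h.1⟩ ⟨e, h.2⟩ t else 0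
  else 0

/-- The initial memory. Arrays of naturals: number 0 holds `n`, number 1 holds `m`, number 2 is the
0-1 matrix of the sets `access i`. Arrays of reals: number 0 holds the coefficients `cost i`,
number 1 holds `L`, number 2 holds `ε`. All other cells are zero. -/
noncomputable def input (L ε : ℝ) : RealRAM.Store where
  nats a i j :=
    if a = 0 ∧ i = 0 ∧ j = 0 then n
    else if a = 1 ∧ i = 0 ∧ j = 0 then m
    else if a = 2 then
      if h : i < n ∧ j < m then
        if (⟨j, h.2⟩ : Fin m) ∈ M.access ⟨i, h.1⟩ then 1 else 0
      else 0
    else 0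
  reals a i j :=
    if a = 0 ∧ j = 0 then
      if h : i < n then M.cost ⟨i, h⟩ else 0
    else if a = 1 ∧ i = 0 ∧ j = 0 then L
    else if a = 2 ∧ i = 0 ∧ j = 0 then ε
    else 0

/-- The profile that is read off the final memory: array number 3 of the reals. -/
def output (n m : ℕ) (s : RealRAM.Store) : Fin n → Fin m → ℝ :=
  fun i e => s.reals 3 i e

end Oligopoly

/-! Production is discretized. Each firm owns `B` units of size `δ` and places all of them, on its
markets or on an extra resource `m` that stands for not producing. Up to a constant, its utility is
a sum of marginal gains of single units, and by concavity of prices and convexity of costs such a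
gain decreases in the load of the resource and in the firm's own units there (`gain_anti`). By an
exchange argument, a firm that gains by no shift of a single unit then plays a best response among
all distributions of its units (`sum_gain_le`). Rounding an arbitrary deviation down to multiples of
`δ` lowers costs and loses at most `δ * (L * U)` of revenue per market, where all prices are
negative at `U`. So for `m * (δ * (L * U)) ≤ ε` an equilibrium of the unit game is an
`ε`-approximate equilibrium (`isApproxEquilibrium_of_settled`).

To compute it, units enter one at a time, each on a best resource of its owner. Let `ℓ` be the loads
before an insertion. Afterwards the profile is settled for `ℓ`, while the true loads exceed `ℓ` by
one unit on a single hot resource `f`; hence only shifts away from `f` can be profitable. Shifting a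
unit from `f` to a best resource `g` reproduces the same situation with `g` hot and with the same
`ℓ`. With `ℓ` frozen, the shifted unit moves to a strictly larger value among finitely many gains `h
k e (ℓ e) q`, so the sum of the ranks of these values is a polynomially bounded potential that every
shift increases (`Settling.step`). The number of phases is `n * B`, and `B` is polynomial in the
parameters. -/

namespace UnitGame

/-! ### The unit game: exchange arguments and potential -/

open Finset

/-- One more unit of player `k` on resource `e`. -/
def addUnit (x : ℕ → ℕ → ℕ) (k e : ℕ) : ℕ → ℕ → ℕ :=
  fun k' e' => x k' e' + if k' = k ∧ e' = e then 1 else 0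

/-- The total number of units on resource `e`. -/
def load (n : ℕ) (x : ℕ → ℕ → ℕ) (e : ℕ) : ℕ := ∑ k ∈ range n, x k e

theorem addUnit_self (x : ℕ → ℕ → ℕ) (k e : ℕ) : addUnit x k e k e = x k e + 1 := by
  simp [addUnit]

theorem addUnit_of_ne_right (x : ℕ → ℕ → ℕ) (k : ℕ) {e e' : ℕ} (k' : ℕ) (h : e' ≠ e) :
    addUnit x k e k' e' = x k' e' := by
  simp [addUnit, h]

theorem addUnit_of_ne_left (x : ℕ → ℕ → ℕ) {k k' : ℕ} (e e' : ℕ) (h : k' ≠ k) :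
    addUnit x k e k' e' = x k' e' := by
  simp [addUnit, h]

theorem le_addUnit (x : ℕ → ℕ → ℕ) (k e k' e' : ℕ) : x k' e' ≤ addUnit x k e k' e' := by
  simp [addUnit]

theorem exists_eq_addUnit {x : ℕ → ℕ → ℕ} {k e : ℕ} (h : 0 < x k e) : ∃ w, x = addUnit w k e := by
  refine ⟨fun k' e' => x k' e' - if k' = k ∧ e' = e then 1 else 0, ?_⟩
  funext k' e'
  by_cases hk : k' = k ∧ e' = e
  · obtain ⟨rfl, rfl⟩ := hk
    simp [addUnit]; omega
  · simp [addUnit, hk]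

theorem load_addUnit {n k : ℕ} (hk : k < n) (x : ℕ → ℕ → ℕ) (e e' : ℕ) :
    load n (addUnit x k e) e' = load n x e' + if e' = e then 1 else 0 := by
  by_cases h : e' = e <;> simp [load, addUnit, sum_add_distrib, h, hk]

theorem sum_addUnit {m e : ℕ} (he : e ≤ m) (x : ℕ → ℕ → ℕ) (k k' : ℕ) :
    ∑ e' ∈ range (m + 1), addUnit x k e k' e' =
      (∑ e' ∈ range (m + 1), x k' e') + if k' = k then 1 else 0 := by
  have : e < m + 1 := by omega
  by_cases h : k' = k <;> simp [addUnit, sum_add_distrib, h, this]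

/-- With the loads `ℓ`, no player gains by shifting one unit between two of his resources. Here
`h k e l q` is what player `k` gains by adding a unit to `e` if `e` carries `l` units, `q` of which
are his. -/
def Settled (R : ℕ → Finset ℕ) (h : ℕ → ℕ → ℕ → ℕ → ℝ) (ℓ : ℕ → ℕ) (x : ℕ → ℕ → ℕ) : Prop :=
  ∀ k, ∀ e ∈ R k, 0 < x k e → ∀ g ∈ R k, h k g (ℓ g) (x k g) ≤ h k e (ℓ e - 1) (x k e - 1)

variable {R : ℕ → Finset ℕ} {h : ℕ → ℕ → ℕ → ℕ → ℝ} {ℓ : ℕ → ℕ} {x w : ℕ → ℕ → ℕ}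

/-- The loads `ℓ` are not updated, so the other players see no change. For player `k` the new unit
has the maximal gain among all possible additions, and more own units only lower the gain of a
further unit. -/
theorem Settled.addUnit
    (anti : ∀ k, ∀ e ∈ R k, ∀ l l' q q', l ≤ l' → q ≤ q' → h k e l' q' ≤ h k e l q)
    (hw : Settled R h ℓ w) {k g : ℕ} (hg : g ∈ R k)
    (hmax : ∀ e ∈ R k, h k e (ℓ e) (w k e) ≤ h k g (ℓ g) (w k g)) :
    Settled R h ℓ (addUnit w k g) := by
  intro k' e he hpos f hf
  by_cases hk : k' = k
  · subst hk
    have h1 : h k' f (ℓ f) (UnitGame.addUnit w k' g k' f) ≤ h k' f (ℓ f) (w k' f) :=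
      anti _ _ hf _ _ _ _ le_rfl (le_addUnit _ _ _ _ _)
    refine h1.trans ?_
    by_cases heg : e = g
    · subst heg
      refine (hmax f hf).trans (anti _ _ he _ _ _ _ (Nat.sub_le _ _) ?_)
      simp [addUnit_self]
    · rw [addUnit_of_ne_right _ _ _ heg] at hpos ⊢
      exact hw _ _ he hpos _ hf
  · rw [addUnit_of_ne_left _ _ _ hk] at hpos ⊢
    rw [addUnit_of_ne_left _ _ _ hk]
    exact hw _ _ he hpos _ hf

/-- The only new temptation after the removal is to return to `f`. That gain is below the one on
`g`, which no remaining unit of `k` wanted to exchange for its own. -/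
theorem Settled.of_addUnit
    (anti : ∀ k, ∀ e ∈ R k, ∀ l l' q q', l ≤ l' → q ≤ q' → h k e l' q' ≤ h k e l q)
    {k f g : ℕ} (hx : Settled R h ℓ (UnitGame.addUnit w k f)) (hf : f ∈ R k) (hg : g ∈ R k)
    (hgf : g ≠ f) (hlt : h k f (ℓ f) (w k f) < h k g (ℓ g) (w k g)) :
    Settled R h ℓ w := by
  intro k' e he hpos e' he'
  by_cases hk : k' = k
  · subst hk
    by_cases h' : e' = f
    · subst h'
      by_cases hee : e = e'
      · subst hee
        exact anti _ _ he _ _ _ _ (Nat.sub_le _ _) (Nat.sub_le _ _)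
      · have := hx k' e he (by rwa [addUnit_of_ne_right _ _ _ hee]) g hg
        rw [addUnit_of_ne_right _ _ _ hee, addUnit_of_ne_right _ _ _ hgf] at this
        exact hlt.le.trans this
    · have := hx k' e he (hpos.trans_le (le_addUnit _ _ _ _ _)) e' he'
      rw [addUnit_of_ne_right _ _ _ h'] at this
      exact this.trans (anti _ _ he _ _ _ _ le_rfl
        (Nat.sub_le_sub_right (le_addUnit _ _ _ _ _) _))
  · have := hx k' e he (by rwa [addUnit_of_ne_left _ _ _ hk]) e' he'
    rwa [addUnit_of_ne_left _ _ _ hk, addUnit_of_ne_left _ _ _ hk] at this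

/-- A higher load on `f` makes `f` less attractive as a target; only units lying on `f` can become
dissatisfied, and `hf` covers these. -/
theorem Settled.raise
    (anti : ∀ k, ∀ e ∈ R k, ∀ l l' q q', l ≤ l' → q ≤ q' → h k e l' q' ≤ h k e l q)
    (hx : Settled R h ℓ x) {ℓ' : ℕ → ℕ} {f : ℕ} (hℓ : ∀ e, ℓ' e = ℓ e + if e = f then 1 else 0)
    (hf : ∀ k, f ∈ R k → 0 < x k f →
      ∀ g ∈ R k, h k g (ℓ' g) (x k g) ≤ h k f (ℓ f) (x k f - 1)) :
    Settled R h ℓ' x := by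
  intro k e he hpos g hg
  by_cases hef : e = f
  · subst hef
    simpa [hℓ e] using hf k he hpos g hg
  · have h1 : ℓ' e = ℓ e := by simp [hℓ, hef]
    rw [h1]
    exact (anti _ _ hg _ _ _ _ (by simp [hℓ]) le_rfl).trans (hx k e he hpos g hg)

/-- The number of values `h k e (ℓ e) q` with `e ≤ m` and `q < B` below `v`. -/
noncomputable def rank (m B : ℕ) (h : ℕ → ℕ → ℕ → ℕ → ℝ) (ℓ : ℕ → ℕ) (k : ℕ) (v : ℝ) : ℕ := by
  classical exact #{p ∈ range (m + 1) ×ˢ range B | h k p.1 (ℓ p.1) p.2 < v}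

theorem rank_le (m B : ℕ) (h : ℕ → ℕ → ℕ → ℕ → ℝ) (ℓ : ℕ → ℕ) (k : ℕ) (v : ℝ) :
    rank m B h ℓ k v ≤ (m + 1) * B := by
  classical
  refine (card_filter_le _ _).trans ?_
  simp

/-- The value itself is counted on the right but not on the left; `q < B` puts it within the range
that is counted. -/
theorem rank_lt {m B : ℕ} {k e q : ℕ} {v : ℝ} (he : e ≤ m) (hq : q < B)
    (hlt : h k e (ℓ e) q < v) : rank m B h ℓ k (h k e (ℓ e) q) < rank m B h ℓ k v := by
  classical
  refine card_lt_card ⟨fun p hp => ?_, fun hsub => ?_⟩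
  · simp only [mem_filter] at hp ⊢
    exact ⟨hp.1, hp.2.trans hlt⟩
  · have : (e, q) ∈ ({p ∈ range (m + 1) ×ˢ range B | h k p.1 (ℓ p.1) p.2 < v} : Finset _) := by
      simp [hlt, hq]; omega
    simpa using (mem_filter.1 (hsub this)).2

/-- The sum of the ranks of all placed units. -/
noncomputable def potential (n m B : ℕ) (h : ℕ → ℕ → ℕ → ℕ → ℝ) (ℓ : ℕ → ℕ)
    (x : ℕ → ℕ → ℕ) : ℕ :=
  ∑ k ∈ range n, ∑ e ∈ range (m + 1), ∑ q ∈ range (x k e), rank m B h ℓ k (h k e (ℓ e) q)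

/-- Ranks refer to the frozen `ℓ` and not to the loads of the profile, so a new unit leaves the
ranks of all others unchanged. -/
theorem potential_addUnit {n m : ℕ} (B : ℕ) {k e : ℕ} (hk : k < n) (he : e ≤ m) :
    potential n m B h ℓ (addUnit w k e) =
      potential n m B h ℓ w + rank m B h ℓ k (h k e (ℓ e) (w k e)) := by
  have key : ∀ k' e', ∑ q ∈ range (addUnit w k e k' e'), rank m B h ℓ k' (h k' e' (ℓ e') q) =
      (∑ q ∈ range (w k' e'), rank m B h ℓ k' (h k' e' (ℓ e') q)) +
        if k' = k then if e' = e then rank m B h ℓ k (h k e (ℓ e) (w k e)) else 0 else 0 := by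
    intro k' e'
    by_cases h1 : k' = k <;> by_cases h2 : e' = e <;> simp [addUnit, h1, h2, sum_range_succ]
  have he' : e < m + 1 := by omega
  simp only [potential, key, sum_add_distrib]
  simp [sum_ite_irrel, hk, he']

theorem potential_le {n m B : ℕ} (hx : ∀ k < n, ∑ e ∈ range (m + 1), x k e ≤ B) :
    potential n m B h ℓ x ≤ n * (B * ((m + 1) * B)) := by
  calc potential n m B h ℓ x
      ≤ ∑ k ∈ range n, ∑ e ∈ range (m + 1), ∑ q ∈ range (x k e), (m + 1) * B := by
        unfold potential
        gcongr
        exact rank_le _ _ _ _ _ _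
    _ = ∑ k ∈ range n, (∑ e ∈ range (m + 1), x k e) * ((m + 1) * B) := by
        simp [sum_mul]
    _ ≤ ∑ k ∈ range n, B * ((m + 1) * B) := by
        gcongr with k hk
        exact hx k (mem_range.1 hk)
    _ = _ := by simp

/-- A threshold separates the used from the unused gains, so that the sums of the used gains are
maximal among all allocations of the same number of units. -/
theorem sum_gain_le {S : Finset ℕ} {f : ℕ → ℕ → ℝ} (anti : ∀ e ∈ S, Antitone (f e)) {y z : ℕ → ℕ}
    (hy : ∀ e ∈ S, 0 < y e → ∀ g ∈ S, f g (y g) ≤ f e (y e - 1))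
    (hyz : ∑ e ∈ S, z e = ∑ e ∈ S, y e) :
    ∑ e ∈ S, ∑ q ∈ range (z e), f e q ≤ ∑ e ∈ S, ∑ q ∈ range (y e), f e q := by
  rcases S.eq_empty_or_nonempty with rfl | hS
  · simp
  obtain ⟨g, hg, hmax⟩ := exists_max_image S (fun e => f e (y e)) hS
  set t := f g (y g) with ht
  -- The threshold `t` is the best unused gain of `y`: used gains are at least `t`, unused ones at
  -- most `t`. As `y` and `z` have equally many units, subtracting `t` from every gain does not
  -- affect the comparison.
  have hle : ∀ e ∈ S, ∑ q ∈ range (z e), (f e q - t) ≤ ∑ q ∈ range (y e), (f e q - t) := by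
    intro e he
    rcases le_total (y e) (z e) with hc | hc
    · rw [← sum_range_add_sum_Ico _ hc]
      have : ∑ q ∈ Ico (y e) (z e), (f e q - t) ≤ 0 := by
        refine sum_nonpos fun q hq => ?_
        have := anti e he (mem_Ico.1 hq).1
        have := hmax e he
        linarith
      linarith
    · rw [← sum_range_add_sum_Ico _ hc]
      have : 0 ≤ ∑ q ∈ Ico (z e) (y e), (f e q - t) := by
        refine sum_nonneg fun q hq => ?_
        have h1 := mem_Ico.1 hq
        have h2 := anti e he (show q ≤ y e - 1 by omega)
        have h3 := hy e he (by omega) g hg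
        linarith
      linarith
  have := sum_le_sum hle
  simp only [sum_sub_distrib, sum_const, card_range, nsmul_eq_mul, ← sum_mul] at this
  have hc : (∑ e ∈ S, (z e : ℝ)) = ∑ e ∈ S, (y e : ℝ) := by exact_mod_cast hyz
  rw [hc] at this
  linarith

end UnitGame

/-! ### Total correctness rules with step bounds -/

namespace RealRAM

theorem setCell_same {α : Type} (f : ℕ → ℕ → ℕ → α) (a i j : ℕ) (v : α) :
    setCell f a i j v a i j = v := by
  simp [setCell]

theorem setCell_array {α : Type} (f : ℕ → ℕ → ℕ → α) {a a' : ℕ} (i j : ℕ) (v : α) (h : a' ≠ a) :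
    setCell f a i j v a' = f a' := by
  funext i' j'
  simp [setCell, h]

/-- Started in `s`, the program `p` halts after at most `T` steps in a store with property `Q`. -/
def Reaches (O : ℕ → ℕ → ℝ → ℝ) (p : Program) (s : Store) (T : ℕ) (Q : Store → Prop) : Prop :=
  ∃ s' t, Runs O p s s' t ∧ t ≤ T ∧ Q s'

variable {O : ℕ → ℕ → ℝ → ℝ} {p q : Program} {s : Store} {T T' : ℕ} {P Q : Store → Prop}

theorem Reaches.mono (h : Reaches O p s T P) (hT : T ≤ T') (hPQ : ∀ s', P s' → Q s') :
    Reaches O p s T' Q := by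
  obtain ⟨s', t, hr, ht, hP⟩ := h
  exact ⟨s', t, hr, ht.trans hT, hPQ _ hP⟩

theorem Reaches.seq (h : Reaches O p s T P) (h' : ∀ s', P s' → Reaches O q s' T' Q) :
    Reaches O (.seq p q) s (T + T') Q := by
  obtain ⟨s', t, hr, ht, hP⟩ := h
  obtain ⟨s'', t', hr', ht', hQ⟩ := h' s' hP
  exact ⟨s'', _, .seq hr hr', Nat.add_le_add ht ht', hQ⟩

theorem Reaches.setNat {a : ℕ} {i j v : NatExp}
    (h : Q { s with nats := setCell s.nats a (i.eval s) (j.eval s) (v.eval s) }) :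
    Reaches O (.setNat a i j v) s (i.steps + j.steps + v.steps + 1) Q :=
  ⟨_, _, .setNat s a i j v, le_rfl, h⟩

theorem Reaches.setReal {a : ℕ} {i j : NatExp} {v : RealExp}
    (h : Q { s with reals := setCell s.reals a (i.eval s) (j.eval s) (v.eval O s) }) :
    Reaches O (.setReal a i j v) s (i.steps + j.steps + v.steps + 1) Q :=
  ⟨_, _, .setReal s a i j v, le_rfl, h⟩

theorem Reaches.branch {b : Test} (h : b.Holds O s → Reaches O p s T Q)
    (h' : ¬ b.Holds O s → Reaches O q s T Q) : Reaches O (.branch b p q) s (b.steps + T) Q := by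
  by_cases hb : b.Holds O s
  · obtain ⟨s', t, hr, ht, hQ⟩ := h hb
    exact ⟨s', _, .branchTrue hb hr, Nat.add_le_add_left ht _, hQ⟩
  · obtain ⟨s', t, hr, ht, hQ⟩ := h' hb
    exact ⟨s', _, .branchFalse hb hr, Nat.add_le_add_left ht _, hQ⟩

/-- A loop whose invariant carries a bound for the number of further iterations. -/
theorem Reaches.loop {b : Test} (Inv : ℕ → Store → Prop)
    (body : ∀ r s, Inv r s → b.Holds O s → Reaches O p s T fun s' => ∃ r' < r, Inv r' s')
    {r : ℕ} (h : Inv r s) :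
    Reaches O (.loop b p) s (r * (b.steps + T) + b.steps)
      fun s' => (∃ r', Inv r' s') ∧ ¬ b.Holds O s' := by
  induction r using Nat.strong_induction_on generalizing s with
  | _ r ih =>
    by_cases hb : b.Holds O s
    · obtain ⟨s', t, hr, ht, r', hr', hI⟩ := body r s h hb
      obtain ⟨s'', t', hr'', ht', hQ⟩ := ih r' hr' hI
      refine ⟨s'', _, .loopStep hb hr hr'', ?_, hQ⟩
      have : (r' + 1) * (b.steps + T) ≤ r * (b.steps + T) := Nat.mul_le_mul_right _ hr'
      rw [Nat.succ_mul] at this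
      omega
    · exact ⟨s, _, .loopDone hb, by omega, ⟨r, h⟩, hb⟩

/-- The scalar variable stored at the origin of array `a` of the naturals. -/
abbrev natVar (a : ℕ) : NatExp := .cell a (.const 0) (.const 0)

/-- The scalar variable stored at the origin of array `a` of the reals. -/
abbrev realVar (a : ℕ) : RealExp := .cell a (.const 0) (.const 0)

/-- Assignment to a scalar variable. -/
abbrev assignNat (a : ℕ) (v : NatExp) : Program := .setNat a (.const 0) (.const 0) v

/-- Assignment to a scalar variable. -/
abbrev assignReal (a : ℕ) (v : RealExp) : Program := .setReal a (.const 0) (.const 0) v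

/-- The test `u < v`. -/
abbrev natLt (u v : NatExp) : Test := .not (.natLe v u)

/-- The test `u < v`. -/
abbrev realLt (u v : RealExp) : Test := .not (.realLe v u)

/-- Run `p` with the variable `a` going from `0` to the value of the variable `c`, exclusively. -/
def forLoop (a c : ℕ) (p : Program) : Program :=
  .seq (assignNat a (.const 0))
    (.loop (natLt (natVar a) (natVar c)) (.seq p (assignNat a (.add (natVar a) (.const 1)))))

/-- An iteration costs 8 steps for the test and 8 for the increment besides the body; 4 for the
initialization and 8 for the last test make up the 12. -/
theorem Reaches.forLoop {a c N : ℕ} (hac : c ≠ a) (Inv : ℕ → Store → Prop)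
    (hN : s.nats c 0 0 = N) (h0 : Inv 0 { s with nats := setCell s.nats a 0 0 0 })
    (body : ∀ i < N, ∀ s, Inv i s → s.nats a 0 0 = i →
      Reaches O p s T fun s' => s'.nats a 0 0 = i ∧ s'.nats c 0 0 = s.nats c 0 0 ∧
        Inv (i + 1) { s' with nats := setCell s'.nats a 0 0 (i + 1) }) :
    Reaches O (forLoop a c p) s (N * (T + 16) + 12) fun s' => Inv N s' := by
  refine ((Reaches.setNat (Q := fun s' => s'.nats a 0 0 = 0 ∧ s'.nats c 0 0 = N ∧ Inv 0 s')
    ⟨?_, ?_, h0⟩).seq (T' := N * (8 + (T + 8)) + 8) fun s' hs' => ?_).mono ?_ fun s' hs' => hs'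
  · simp [setCell, NatExp.eval]
  · simp [setCell, NatExp.eval, hac, hN]
  · refine (Reaches.loop (r := N) (T := T + 8) (fun r s => ∃ i, i + r = N ∧ s.nats a 0 0 = i ∧
      s.nats c 0 0 = N ∧ Inv i s) ?_ ⟨0, by simp, hs'⟩).mono ?_ ?_
    · rintro r s ⟨i, hir, hi, hc, hI⟩ hb
      simp only [Test.Holds, NatExp.eval, hi, hc] at hb
      refine ((body i (by omega) s hI hi).seq (T' := 8) fun s' ⟨h1, h2, h3⟩ => ?_)
      refine Reaches.mono (Reaches.setNat ?_) (by simp [NatExp.steps]) fun _ h => h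
      refine ⟨r - 1, by omega, i + 1, by omega, ?_, ?_, ?_⟩
      · simp [setCell, NatExp.eval, h1]
      · simp [setCell, NatExp.eval, hac, h2, hc]
      · simpa [NatExp.eval, h1] using h3
    · simp [Test.steps, NatExp.steps]
    · rintro s'' ⟨⟨r', i, hir, hi, hc, hI⟩, hb⟩
      simp only [Test.Holds, NatExp.eval, hi, hc] at hb
      have : i = N := by omega
      exact this ▸ hI
  · simp [NatExp.steps]
    ring_nf
    omega

end RealRAM

/-! ### Marginal gains in an oligopoly and the rounding error -/

theorem ConcaveOn.sub_le_sub_of_le {p : ℝ → ℝ} (hp : ConcaveOn ℝ Set.univ p) {a b d : ℝ}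
    (hab : a ≤ b) (hd : 0 ≤ d) : p (b + d) - p b ≤ p (a + d) - p a := by
  rcases hd.eq_or_lt with rfl | hd
  · simp
  have hpos : 0 < b - a + d := by linarith
  have hne := hpos.ne'
  have h0 : 0 ≤ (b - a) / (b - a + d) := div_nonneg (by linarith) hpos.le
  have h1 : 0 ≤ d / (b - a + d) := by positivity
  have hs : (b - a) / (b - a + d) + d / (b - a + d) = 1 := by field_simp
  -- Both `a + d` and `b` are convex combinations of `a` and `b + d`, with interchanged weights;
  -- adding the two concavity inequalities gives the claim.
  have e1 := hp.2 (Set.mem_univ a) (Set.mem_univ (b + d)) h0 h1 hs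
  have e2 := hp.2 (Set.mem_univ a) (Set.mem_univ (b + d)) h1 h0 (by rw [add_comm, hs])
  simp only [smul_eq_mul] at e1 e2
  have c1 : (b - a) / (b - a + d) * a + d / (b - a + d) * (b + d) = a + d := by
    field_simp; ring
  have c2 : d / (b - a + d) * a + (b - a) / (b - a + d) * (b + d) = b := by
    field_simp; ring
  rw [c1] at e1
  rw [c2] at e2
  have : (b - a) / (b - a + d) * p a + d / (b - a + d) * p a = p a := by
    rw [← add_mul, hs, one_mul]
  have : (b - a) / (b - a + d) * p (b + d) + d / (b - a + d) * p (b + d) = p (b + d) := by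
    rw [← add_mul, hs, one_mul]
  linarith

namespace Oligopoly

open Finset UnitGame

variable {n m : ℕ} (M : Oligopoly n m)

/-- The markets of firm `k`, and the resource `m` that stands for not producing. -/
def resources (k : ℕ) : Finset ℕ :=
  insert m (if h : k < n then (M.access ⟨k, h⟩).map Fin.valEmbedding else ∅)

/-- The coefficient of the production costs of firm `k`. -/
def costCoeff (k : ℕ) : ℝ := if h : k < n then M.cost ⟨k, h⟩ else 0

/-- What firm `k` gains from one more unit, of size `δ`, on the resource `e` if `e` carries `l`
units of which `q` are its own, where the firm has `B` units. -/
noncomputable def gain (δ : ℝ) (B k e l q : ℕ) : ℝ :=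
  if e < m then
    M.priceOracle k e (l * δ + δ) * (q * δ + δ) - M.priceOracle k e (l * δ) * (q * δ)
  else M.costCoeff k * ((B * δ - q * δ) * (B * δ - q * δ)
    - (B * δ - q * δ - δ) * (B * δ - q * δ - δ))

theorem costCoeff_nonneg (k : ℕ) : 0 ≤ M.costCoeff k := by
  unfold costCoeff
  split_ifs with h
  · exact M.cost_nonneg _
  · exact le_rfl

theorem mem_resources {k e : ℕ} : e ∈ M.resources k ↔
    e = m ∨ ∃ (hk : k < n) (he : e < m), (⟨e, he⟩ : Fin m) ∈ M.access ⟨k, hk⟩ := by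
  unfold resources
  split_ifs with h
  · simp only [mem_insert, mem_map, Fin.valEmbedding_apply, h, exists_true_left]
    refine or_congr_right ⟨?_, ?_⟩
    · rintro ⟨a, ha, rfl⟩
      exact ⟨a.2, ha⟩
    · rintro ⟨he, h'⟩
      exact ⟨_, h', rfl⟩
  · simp [h]

theorem priceOracle_of_mem {i : Fin n} {e : Fin m} (h : e ∈ M.access i) :
    M.priceOracle i e = M.price i e := by
  funext t
  simp [priceOracle, h]

/-- With `p` the price, the gain on a market is `δ * p (l * δ + δ) + q * δ * (p (l * δ + δ) - p (l *
δ))`. The first term falls since `p` is antitone; in the second the difference is nonpositive and,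
by concavity, decreasing in `l`. On the resource `m` the gain is affine in `q` with nonpositive
slope. -/
theorem gain_anti {δ : ℝ} (hδ : 0 ≤ δ) (B : ℕ) (k e : ℕ) (he : e ∈ M.resources k)
    (l l' q q' : ℕ) (hl : l ≤ l') (hq : q ≤ q') : M.gain δ B k e l' q' ≤ M.gain δ B k e l q := by
  have hq' : (q : ℝ) ≤ q' := by exact_mod_cast hq
  unfold gain
  split_ifs with hm
  · obtain rfl | ⟨hk, he, hacc⟩ := M.mem_resources.1 he
    · exact absurd hm (lt_irrefl _)
    have hO := M.priceOracle_of_mem hacc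
    simp only at hO
    rw [hO]
    set p := M.price ⟨k, hk⟩ ⟨e, he⟩
    have hanti : Antitone p := M.price_antitone _ _ hacc
    have hl' : (l : ℝ) * δ ≤ l' * δ := by gcongr
    have h1 := (M.price_concave _ _ hacc).sub_le_sub_of_le hl' hδ
    have h2 : p (l' * δ + δ) ≤ p (l * δ + δ) := hanti (by linarith)
    have h3 : p (l' * δ + δ) - p (l' * δ) ≤ 0 := by
      have := hanti (show l' * δ ≤ l' * δ + δ by linarith)
      linarith
    have h4 : (q' : ℝ) * δ * (p (l' * δ + δ) - p (l' * δ)) ≤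
        q * δ * (p (l * δ + δ) - p (l * δ)) := by
      calc (q' : ℝ) * δ * (p (l' * δ + δ) - p (l' * δ))
          ≤ q * δ * (p (l' * δ + δ) - p (l' * δ)) :=
            mul_le_mul_of_nonpos_right (by gcongr) h3
        _ ≤ _ := mul_le_mul_of_nonneg_left h1 (by positivity)
    have h5 := mul_le_mul_of_nonneg_left h2 hδ
    linarith
  · refine mul_le_mul_of_nonneg_left ?_ (M.costCoeff_nonneg k)
    have : (q : ℝ) * δ * δ ≤ q' * δ * δ := by gcongr
    linarith

/-- Not producing causes no congestion, so a shift to `m` triggers no further shifts. -/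
theorem gain_resource_last (δ : ℝ) (B k l l' q : ℕ) :
    M.gain δ B k m l q = M.gain δ B k m l' q := by
  simp [gain]

/-- The sum telescopes: the firm places its units one by one on top of the `a` units of the others.
-/
theorem sum_gain_market {δ : ℝ} {B : ℕ} {i : Fin n} {e : Fin m} (he : e ∈ M.access i) (a q : ℕ) :
    ∑ s ∈ range q, M.gain δ B i e (a + s) s = M.price i e (a * δ + q * δ) * (q * δ) := by
  induction q with
  | zero => simp
  | succ q ih =>
    rw [sum_range_succ, ih, gain, if_pos e.2, M.priceOracle_of_mem he]
    push_cast
    rw [show ((a : ℝ) + q) * δ + δ = a * δ + (q + 1) * δ by ring, add_mul (a : ℝ)]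
    ring

theorem sum_gain_last {δ : ℝ} {B : ℕ} (i : Fin n) (a q : ℕ) :
    ∑ s ∈ range q, M.gain δ B i m (a + s) s =
      M.cost i * (B * δ) ^ 2 - M.cost i * (B * δ - q * δ) ^ 2 := by
  induction q with
  | zero => simp
  | succ q ih =>
    rw [sum_range_succ, ih, gain, if_neg (lt_irrefl _)]
    simp only [costCoeff, Fin.is_lt, dif_pos]
    push_cast
    ring

theorem sum_resources (i : Fin n) (f : ℕ → ℝ) :
    ∑ e ∈ M.resources i, f e = f m + ∑ e ∈ M.access i, f e := by
  unfold resources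
  rw [sum_insert, dif_pos i.2, sum_map]
  · rfl
  · simp only [Fin.is_lt, dif_pos, Fin.eta, mem_map, not_exists, not_and]
    intro e _
    exact e.2.ne

theorem sum_resources_nat (i : Fin n) (f : ℕ → ℕ) :
    ∑ e ∈ M.resources i, f e = f m + ∑ e ∈ M.access i, f e := by
  have := M.sum_resources i fun e => (f e : ℝ)
  exact_mod_cast this

/-- If the price at `a + y` is nonnegative, then `a + y ≤ z` and the Lipschitz condition bounds the
price by `L * U`. Rounding `y` down gives up less than one `δ` at this price, and the price does not
fall. -/
theorem exists_rounding {p : ℝ → ℝ} {L : ℝ≥0} {a δ y z U : ℝ} (hp : Antitone p)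
    (hL : LipschitzWith L p) (hz : IsGreatest {t | p t = 0} z) (hz0 : 0 ≤ z) (hzU : z ≤ U)
    (hδ : 0 < δ) (ha : 0 ≤ a) (hy : 0 ≤ y) :
    ∃ q : ℕ, q * δ ≤ y ∧ q * δ ≤ U ∧ p (a + y) * y ≤ p (a + q * δ) * (q * δ) + δ * (L * U) := by
  have hLU : 0 ≤ δ * (L * U) := mul_nonneg hδ.le (mul_nonneg L.2 (hz0.trans hzU))
  rcases le_total (p (a + y)) 0 with hneg | hpos
  -- At a negative price the revenue is nonpositive, so producing nothing is at least as good.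
  · refine ⟨0, by simpa using hy, by simpa using hz0.trans hzU, ?_⟩
    have := mul_nonpos_of_nonpos_of_nonneg hneg hy
    simpa using this.trans hLU
  · have hle : a + y ≤ z := by
      by_contra! hlt
      have h1 : p (a + y) ≤ p z := hp hlt.le
      rw [hz.1] at h1
      exact absurd (hz.2 (le_antisymm h1 hpos)) (not_le.2 hlt)
    have h1 : (⌊y / δ⌋₊ : ℝ) * δ ≤ y := by
      rw [← le_div_iff₀ hδ]
      exact Nat.floor_le (by positivity)
    have h2 : y ≤ ⌊y / δ⌋₊ * δ + δ := by
      have := (Nat.lt_floor_add_one (y / δ)).le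
      rw [div_le_iff₀ hδ] at this
      linarith
    refine ⟨⌊y / δ⌋₊, h1, by linarith, ?_⟩
    set q : ℝ := (⌊y / δ⌋₊ : ℝ)
    have hq : 0 ≤ q * δ := by positivity
    have h3 : p (a + y) ≤ p (a + q * δ) := hp (by linarith)
    have h4 : p (a + y) ≤ L * U := by
      have h5 := hL.dist_le_mul (a + y) z
      have h6 : p z = 0 := hz.1
      rw [h6, dist_zero_right, Real.norm_eq_abs, abs_of_nonneg hpos, Real.dist_eq,
        abs_of_nonpos (by linarith)] at h5
      refine h5.trans (mul_le_mul_of_nonneg_left ?_ L.2)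
      linarith
    calc p (a + y) * y ≤ p (a + y) * (q * δ + δ) := mul_le_mul_of_nonneg_left h2 hpos
      _ = p (a + y) * (q * δ) + δ * p (a + y) := by ring
      _ ≤ _ := add_le_add (mul_le_mul_of_nonneg_right h3 hq)
          (mul_le_mul_of_nonneg_left h4 hδ.le)

/-- The deviation `y` is compared with its rounding `r`, which is an admissible distribution of
units and hence, by `sum_gain_le`, no better than `x i`. -/
theorem isApproxEquilibrium_of_settled {L : ℝ≥0} {ε δ : ℝ} {B U : ℕ} (hδ : 0 < δ)
    (hL : ∀ i, ∀ e ∈ M.access i, LipschitzWith L (M.price i e))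
    (hz : ∀ i, ∀ e ∈ M.access i, ∃ z : ℝ, 0 ≤ z ∧ z ≤ U ∧ IsGreatest {t | M.price i e t = 0} z)
    (hB : (m : ℝ) * U ≤ B * δ) (hε : m * (δ * (L * U)) ≤ ε) {x : ℕ → ℕ → ℕ}
    (hx : Settled M.resources (M.gain δ B) (load n x) x)
    (hsupp : ∀ k e, 0 < x k e → e ∈ M.resources k)
    (hsum : ∀ k < n, ∑ e ∈ range (m + 1), x k e = B) :
    M.IsApproxEquilibrium ε (fun (i : Fin n) (e : Fin m) => (x i e * δ : ℝ)) := by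
  have hzero : ∀ (i : Fin n) (e : Fin m), e ∉ M.access i → x i e = 0 := by
    intro i e he
    by_contra hne
    obtain h | ⟨_, _, h⟩ := M.mem_resources.1 (hsupp i e (Nat.pos_of_ne_zero hne))
    · exact e.2.ne h
    · exact he h
  refine ⟨fun i => ⟨fun e => by positivity, fun e he => by simp [hzero i e he]⟩, ?_⟩
  intro i y hy
  set a : ℕ → ℕ := fun e => ∑ j ∈ univ.erase i, x j e with ha
  have hload : ∀ e, load n x e = a e + x i e := by
    intro e
    rw [load, sum_range (fun k => x k e), ha, sum_erase_add _ _ (mem_univ i)]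
  have hothers : ∀ (u : Fin m → ℝ) (e : Fin m),
      ∑ j, Function.update (fun (i : Fin n) (e : Fin m) => (x i e * δ : ℝ)) i u j e
        = a e * δ + u e := by
    intro u e
    rw [← sum_erase_add _ _ (mem_univ i), Function.update_self, ha]
    push_cast
    rw [sum_mul]
    congr 1
    refine sum_congr rfl fun j hj => ?_
    rw [Function.update_of_ne (ne_of_mem_erase hj)]
  have hself : Function.update (fun (i : Fin n) (e : Fin m) => (x i e * δ : ℝ)) i
      (fun e => x i e * δ) = fun (i : Fin n) (e : Fin m) => (x i e * δ : ℝ) := Function.update_eq_self i _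
  -- The total gain of a distribution of all `B` units is the utility plus the constant `M.cost i *
  -- (B * δ) ^ 2`, the cost saved by leaving all units idle.
  have key : ∀ q : ℕ → ℕ, q m + ∑ e ∈ M.access i, q e = B →
      ∑ e ∈ M.resources i, ∑ s ∈ range (q e), M.gain δ B i e (a e + s) s
        = (∑ e ∈ M.access i, M.price i e (a e * δ + q e * δ) * (q e * δ))
          - M.cost i * (∑ e ∈ M.access i, (q e * δ)) ^ 2 + M.cost i * (B * δ) ^ 2 := by
    intro q hq
    rw [M.sum_resources, M.sum_gain_last, sum_congr rfl fun e he => M.sum_gain_market he _ _]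
    have : (B : ℝ) * δ - q m * δ = ∑ e ∈ M.access i, (q e * δ : ℝ) := by
      rw [← hq, ← sum_mul]
      push_cast
      ring
    rw [this]
    ring
  have hB' : x i m + ∑ e ∈ M.access i, x i e = B := by
    rw [← hsum i i.2, sum_range_succ, sum_range (fun e => x i e), add_comm]
    congr 1
    exact sum_subset (subset_univ _) fun e _ he => hzero i e he
  choose! z hz0 hzU hzmax using hz i
  have hround : ∀ e ∈ M.access i, ∃ q : ℕ, q * δ ≤ y e ∧ q * δ ≤ U ∧
      M.price i e (a e * δ + y e) * y e ≤
        M.price i e (a e * δ + q * δ) * (q * δ) + δ * (L * U) := fun e he =>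
    exists_rounding (M.price_antitone i e he) (hL i e he) (hzmax e he) (hz0 e he) (hzU e he) hδ
      (by positivity) (hy.1 e)
  choose! r hr1 hr2 hr3 using hround
  have hrB : ∑ e ∈ M.access i, r e ≤ B := by
    have h1 : (∑ e ∈ M.access i, (r e : ℝ)) * δ ≤ B * δ := by
      rw [sum_mul]
      calc ∑ e ∈ M.access i, (r e : ℝ) * δ ≤ ∑ e ∈ M.access i, (U : ℝ) := sum_le_sum hr2
        _ = #(M.access i) * U := by simp
        _ ≤ m * U := by
          gcongr
          simpa using card_le_univ (M.access i)
        _ ≤ _ := hB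
    have h2 := le_of_mul_le_mul_right h1 hδ
    exact_mod_cast h2
  -- The units that the rounded deviation leaves over are placed on `m`; `hrB` makes the truncated
  -- subtraction exact.
  set q : ℕ → ℕ := fun e => if h : e < m then r ⟨e, h⟩ else B - ∑ e ∈ M.access i, r e with hqdef
  have hqr : ∀ e : Fin m, q e = r e := fun e => by simp [hqdef]
  have hqB : q m + ∑ e ∈ M.access i, q e = B := by
    simp only [hqr]
    simp only [hqdef, lt_irrefl, dif_neg, not_false_eq_true]
    omega
  have hopt : ∑ e ∈ M.resources i, ∑ s ∈ range (q e), M.gain δ B i e (a e + s) s ≤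
      ∑ e ∈ M.resources i, ∑ s ∈ range (x i e), M.gain δ B i e (a e + s) s := by
    refine sum_gain_le (f := fun e s => M.gain δ B i e (a e + s) s) ?_ ?_ ?_
    · intro e he s s' hs
      exact M.gain_anti hδ.le B i e he _ _ _ _ (by omega) hs
    · intro e he hpos g hg
      have := hx i e he hpos g hg
      rwa [hload, hload, Nat.add_sub_assoc hpos] at this
    · rw [M.sum_resources_nat, M.sum_resources_nat, hqB, hB']
  rw [key _ hqB, key _ hB'] at hopt
  simp only [hqr] at hopt
  have hcurrent : ∀ e : Fin m, ∑ j : Fin n, (x j e * δ : ℝ) = a e * δ + x i e * δ := by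
    intro e
    have := hothers (fun e => x i e * δ) e
    rwa [hself] at this
  simp only [utility, hothers, hcurrent, Function.update_self]
  have hrev : ∑ e ∈ M.access i, M.price i e (a e * δ + y e) * y e ≤
      (∑ e ∈ M.access i, M.price i e (a e * δ + r e * δ) * (r e * δ)) + ε := by
    calc _ ≤ ∑ e ∈ M.access i,
          (M.price i e (a e * δ + r e * δ) * (r e * δ) + δ * (L * U)) := sum_le_sum hr3
      _ = (∑ e ∈ M.access i, M.price i e (a e * δ + r e * δ) * (r e * δ))
          + #(M.access i) * (δ * (L * U)) := by rw [sum_add_distrib]; simp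
      _ ≤ (∑ e ∈ M.access i, M.price i e (a e * δ + r e * δ) * (r e * δ))
          + m * (δ * (L * U)) := by
        gcongr
        simpa using card_le_univ (M.access i)
      _ ≤ _ := by gcongr
  have hcost : M.cost i * (∑ e ∈ M.access i, (r e * δ : ℝ)) ^ 2 ≤
      M.cost i * (∑ e ∈ M.access i, y e) ^ 2 := by
    have := M.cost_nonneg i
    gcongr with e he
    exact hr1 e he
  linarith

end Oligopoly

/-! ### The program for the unit game -/

namespace RealRAM

/-- The program keeps the produced quantities in array 3 of the reals, the total quantities in
array 4, the unit of production in variable 5, and the number of units per firm in variable 4 of the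
naturals. Variable 7 is a firm, variable 8 the best resource for it, and variable 9 the resource that
received a unit last. -/
def ownUnits (e : NatExp) : RealExp := .cell 3 (natVar 7) e

def totalUnits (e : NatExp) : RealExp := .cell 4 e (.const 0)

def unitSize : RealExp := realVar 5

/-- What the current firm gains by one more unit on market `e`. -/
def marketGain (e : NatExp) : RealExp :=
  .sub (.mul (.query (natVar 7) e (.add (totalUnits e) unitSize)) (.add (ownUnits e) unitSize))
    (.mul (.query (natVar 7) e (totalUnits e)) (ownUnits e))

/-- What the current firm loses by one unit less on market `e`. -/
def marketLoss (e : NatExp) : RealExp :=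
  .sub (.mul (.query (natVar 7) e (totalUnits e)) (ownUnits e))
    (.mul (.query (natVar 7) e (.sub (totalUnits e) unitSize)) (.sub (ownUnits e) unitSize))

/-- What the current firm produces. -/
def production : RealExp := .sub (.mul (.cast (natVar 4)) unitSize) (ownUnits (natVar 1))

/-- What the current firm gains by producing one unit less. -/
def costGain : RealExp :=
  .mul (.cell 0 (natVar 7) (.const 0)) (.sub (.mul production production)
    (.mul (.sub production unitSize) (.sub production unitSize)))

/-- Find the best resource for the current firm and its gain. -/
def bestResource : Program :=
  .seq (assignNat 8 (natVar 1)) (.seq (assignReal 6 costGain)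
    (forLoop 6 1 (.branch
      (.and (.natLe (.const 1) (.cell 2 (natVar 7) (natVar 6)))
        (realLt (realVar 6) (marketGain (natVar 6))))
      (.seq (assignNat 8 (natVar 6)) (assignReal 6 (marketGain (natVar 6))))
      .skip)))

/-- Give one more unit on the best resource to the current firm. -/
def insertUnit : Program :=
  .seq (.setReal 3 (natVar 7) (natVar 8) (.add (ownUnits (natVar 8)) unitSize))
    (.setReal 4 (natVar 8) (.const 0) (.add (totalUnits (natVar 8)) unitSize))

/-- Take one unit on the resource that received a unit last from the current firm. -/
def removeUnit : Program :=
  .seq (.setReal 3 (natVar 7) (natVar 9) (.sub (ownUnits (natVar 9)) unitSize))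
    (.setReal 4 (natVar 9) (.const 0) (.sub (totalUnits (natVar 9)) unitSize))

/-- As long as some firm gains by shifting a unit away from the resource that received a unit last,
let it do so. -/
def settle : Program :=
  .loop (.and (natLt (natVar 7) (natVar 0)) (natLt (natVar 9) (natVar 1)))
    (.seq bestResource (.branch
      (.and (.realLe unitSize (ownUnits (natVar 9)))
        (realLt (marketLoss (natVar 9)) (realVar 6)))
      (.seq removeUnit (.seq insertUnit (.seq (assignNat 9 (natVar 8)) (assignNat 7 (.const 0)))))
      (assignNat 7 (.add (natVar 7) (.const 1)))))

/-- Give one more unit to the firm in variable 5. -/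
def unitPhase : Program :=
  .seq (assignNat 7 (natVar 5)) (.seq bestResource (.seq insertUnit
    (.seq (assignNat 9 (natVar 8)) (.seq (assignNat 7 (.const 0)) settle))))

/-- Give all units to all firms. -/
def distribute : Program := forLoop 10 4 (forLoop 5 0 unitPhase)

end RealRAM

/-! ### Correctness of the elementary subprograms -/

namespace Oligopoly

open Finset UnitGame RealRAM

variable {n m : ℕ} (M : Oligopoly n m)

/-- The store `s` describes the units `x` of size `δ`, with `B` units for every firm. -/
structure Stores (δ : ℝ) (B : ℕ) (x : ℕ → ℕ → ℕ) (s : Store) : Prop where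
  firms : s.nats 0 0 0 = n
  markets : s.nats 1 0 0 = m
  access : s.nats 2 = (M.input 0 0).nats 2
  units : s.nats 4 0 0 = B
  cost : ∀ k, s.reals 0 k 0 = M.costCoeff k
  own : ∀ k e, s.reals 3 k e = x k e * δ
  total : ∀ e, s.reals 4 e 0 = load n x e * δ
  size : s.reals 5 0 0 = δ

variable {M} {δ : ℝ} {B : ℕ} {x w : ℕ → ℕ → ℕ} {s s' : Store} {k e : ℕ}

/-- Frame rule: natural arrays from 5 on and real array 6 are scratch memory. -/
theorem Stores.congr (h : M.Stores δ B x s) (hn : ∀ a, a < 5 → s'.nats a = s.nats a)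
    (hr : ∀ a, a ≠ 6 → s'.reals a = s.reals a) : M.Stores δ B x s' where
  firms := by rw [hn _ (by decide), h.firms]
  markets := by rw [hn _ (by decide), h.markets]
  access := by rw [hn _ (by decide), h.access]
  units := by rw [hn _ (by decide), h.units]
  cost k := by rw [hr _ (by decide), h.cost]
  own k e := by rw [hr _ (by decide), h.own]
  total e := by rw [hr _ (by decide), h.total]
  size := by rw [hr _ (by decide), h.size]

theorem one_le_input_access (L ε : ℝ) :
    1 ≤ (M.input L ε).nats 2 k e ↔ e < m ∧ e ∈ M.resources k := by
  rw [mem_resources]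
  constructor
  · intro h
    simp only [input, OfNat.ofNat_ne_zero, OfNat.ofNat_ne_one, false_and, if_false, if_true] at h
    split_ifs at h with h1 h2
    · exact ⟨h1.2, Or.inr ⟨h1.1, h1.2, h2⟩⟩
    · omega
    · omega
  · rintro ⟨he, h | ⟨hk, he', h⟩⟩
    · omega
    · simp [input, hk, he, h]

theorem Stores.eval_marketGain (h : M.Stores δ B x s) (hk : s.nats 7 0 0 = k) {u : NatExp}
    (hu : u.eval s = e) (he : e < m) :
    (marketGain u).eval M.priceOracle s = M.gain δ B k e (load n x e) (x k e) := by
  simp [marketGain, ownUnits, totalUnits, unitSize, RealExp.eval, NatExp.eval, hu, hk, gain, he,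
    h.own, h.total, h.size]

theorem Stores.eval_costGain (h : M.Stores δ B x s) (hk : s.nats 7 0 0 = k) :
    costGain.eval M.priceOracle s = M.gain δ B k m (load n x m) (x k m) := by
  simp [costGain, production, ownUnits, unitSize, RealExp.eval, NatExp.eval, hk, gain,
    h.own, h.size, h.cost, h.units, h.markets]

/-- What the last unit contributes is the gain of adding it to the profile without it. The form
`addUnit w k e` makes the real subtraction of `δ` agree with unit counts without truncation. -/
theorem Stores.eval_marketLoss (h : M.Stores δ B (addUnit w k e) s) (hk : s.nats 7 0 0 = k)
    {u : NatExp} (hu : u.eval s = e) (he : e < m) (hkn : k < n) :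
    (marketLoss u).eval M.priceOracle s = M.gain δ B k e (load n w e) (w k e) := by
  simp only [marketLoss, ownUnits, totalUnits, unitSize, RealExp.eval, NatExp.eval, hu, hk, gain,
    he, h.own, h.total, h.size, load_addUnit hkn, addUnit_self, if_true]
  push_cast
  simp [add_mul]

theorem Stores.bestResource (h : M.Stores δ B x s) (hk : s.nats 7 0 0 = k) :
    Reaches M.priceOracle bestResource s (300 * (m + 1)) fun s' =>
      (∀ a, a ≠ 6 → a ≠ 8 → s'.nats a = s.nats a) ∧ (∀ a, a ≠ 6 → s'.reals a = s.reals a) ∧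
      ∃ g ∈ M.resources k, s'.nats 8 0 0 = g ∧
        s'.reals 6 0 0 = M.gain δ B k g (load n x g) (x k g) ∧
        ∀ e ∈ M.resources k,
          M.gain δ B k e (load n x e) (x k e) ≤ M.gain δ B k g (load n x g) (x k g) := by
  set G : ℕ → ℝ := fun e => M.gain δ B k e (load n x e) (x k e) with hG
  have hm : m ∈ M.resources k := M.mem_resources.2 (Or.inl rfl)
  -- The scan visits only `e < m`; the initial candidate `m`, available to every firm, needs the
  -- separate clause `G m ≤ G g`.
  let Inv : ℕ → Store → Prop := fun j s' =>
      (∀ a, a ≠ 6 → a ≠ 8 → s'.nats a = s.nats a) ∧ (∀ a, a ≠ 6 → s'.reals a = s.reals a) ∧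
      ∃ g ∈ M.resources k, s'.nats 8 0 0 = g ∧ s'.reals 6 0 0 = G g ∧ G m ≤ G g ∧
        ∀ e ∈ M.resources k, e < j → G e ≤ G g
  refine Reaches.mono (P := Inv m) (Reaches.seq (T := 6) (T' := 200 + (m * (150 + 16) + 12))
    (P := fun s' => s'.nats = setCell s.nats 8 0 0 m ∧ s'.reals = s.reals) ?_ ?_) ?_
    ?_
  · exact (Reaches.setNat ⟨by simp [NatExp.eval, h.markets], rfl⟩).mono (by decide) fun _ h => h
  · rintro s1 ⟨h1, h1'⟩
    have hs1 : M.Stores δ B x s1 := h.congr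
      (fun a ha => by rw [h1, setCell_array _ _ _ _ (by omega)]) (fun a _ => by rw [h1'])
    have hk1 : s1.nats 7 0 0 = k := by rw [h1, setCell_array _ _ _ _ (by omega), hk]
    refine Reaches.seq (T := 200) (P := fun s' => s'.nats = s1.nats ∧
      s'.reals = setCell s.reals 6 0 0 (G m)) ?_ ?_
    · refine (Reaches.setReal ⟨rfl, ?_⟩).mono (by decide) fun _ h => h
      simp only [NatExp.eval, hs1.eval_costGain hk1, h1', hG]
    · rintro s2 ⟨h2, h2'⟩
      refine (Reaches.forLoop (N := m) (T := 150) (by decide) Inv ?_ ?_ ?_)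
      · rw [h2, hs1.markets]
      · refine ⟨fun a ha ha' => ?_, fun a ha => ?_, m, hm, ?_, ?_, le_rfl, ?_⟩
        · simp only
          rw [setCell_array _ _ _ _ ha, h2, h1, setCell_array _ _ _ _ ha']
        · simp only
          rw [h2', setCell_array _ _ _ _ ha]
        · simp only
          rw [setCell_array _ _ _ _ (by decide), h2, h1, setCell_same]
        · simp only
          rw [h2', setCell_same]
        · intro e _ he
          omega
      · rintro j hj s3 ⟨hn3, hr3, g, hg, hg8, hg6, hgm, hge⟩ hj3
        have hs3 : M.Stores δ B x s3 := h.congr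
          (fun a ha => hn3 a (by omega) (by omega)) hr3
        have hk3 : s3.nats 7 0 0 = k := by rw [hn3 _ (by decide) (by decide), hk]
        have hGj := hs3.eval_marketGain hk3 (u := natVar 6) (e := j) (by simpa [NatExp.eval]) hj
        have hacc : 1 ≤ s3.nats 2 k j ↔ j ∈ M.resources k := by
          rw [hs3.access, one_le_input_access]
          simp [hj]
        refine (Reaches.branch (T := 64) (fun hb => ?_) (fun hb => ?_)).mono (by decide)
          fun _ h => h
        · simp only [Test.Holds, NatExp.eval, RealExp.eval, hk3, hj3, hGj, hg6, not_le, hacc] at hb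
          refine Reaches.mono (Reaches.seq (T := 6) (T' := 58)
            (P := fun s' => s'.nats = setCell s3.nats 8 0 0 j ∧ s'.reals = s3.reals)
            ?_ ?_) (by decide) fun _ h => h
          · exact (Reaches.setNat ⟨by simp [NatExp.eval, hj3], rfl⟩).mono (by decide) fun _ h => h
          · rintro s4 ⟨h4, h4'⟩
            have hs4 : M.Stores δ B x s4 := hs3.congr
              (fun a ha => by rw [h4, setCell_array _ _ _ _ (by omega)]) (fun a _ => by rw [h4'])
            have hk4 : s4.nats 7 0 0 = k := by rw [h4, setCell_array _ _ _ _ (by omega), hk3]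
            have hj4 : s4.nats 6 0 0 = j := by rw [h4, setCell_array _ _ _ _ (by omega), hj3]
            have hG4 := hs4.eval_marketGain hk4 (u := natVar 6) (e := j)
              (by simpa [NatExp.eval]) hj
            refine (Reaches.setReal ⟨hj4, ?_, ⟨fun a ha ha' => ?_, fun a ha => ?_, j, hb.1, ?_, ?_,
              hgm.trans hb.2.le, fun e he hej => ?_⟩⟩).mono (by decide) fun _ h => h
            · simp only
              rw [h4, setCell_array _ _ _ _ (by omega)]
            · simp only
              rw [setCell_array _ _ _ _ ha, h4, setCell_array _ _ _ _ ha', hn3 a ha ha']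
            · simp only
              rw [setCell_array _ _ _ _ ha, h4', hr3 a ha]
            · simp only
              rw [setCell_array _ _ _ _ (by decide), h4, setCell_same]
            · simp only [NatExp.eval]
              rw [setCell_same, hG4]
            · rcases Nat.lt_succ_iff_lt_or_eq.1 hej with h' | rfl
              · exact (hge e he h').trans hb.2.le
              · exact le_rfl
        · simp only [Test.Holds, NatExp.eval, RealExp.eval, hk3, hj3, hGj, hg6, not_le, hacc,
            not_and, not_lt] at hb
          refine Reaches.mono ⟨_, _, Runs.skip _, le_rfl, hj3, rfl, fun a ha ha' => ?_,
            fun a ha => hr3 a ha, g, hg, ?_, hg6, hgm, fun e he hej => ?_⟩ (by decide) fun _ h => h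
          · simp only
            rw [setCell_array _ _ _ _ ha, hn3 a ha ha']
          · simp only
            rw [setCell_array _ _ _ _ (by decide), hg8]
          · rcases Nat.lt_succ_iff_lt_or_eq.1 hej with h' | rfl
            · exact hge e he h'
            · exact hb he
  · omega
  · rintro s' ⟨h1, h2, g, hg, hg8, hg6, hgm, hge⟩
    refine ⟨h1, h2, g, hg, hg8, hg6, fun e he => ?_⟩
    rcases M.mem_resources.1 he with rfl | ⟨_, he', _⟩
    · exact hgm
    · exact hge e he he'

theorem Stores.insertUnit (h : M.Stores δ B x s) (hkn : k < n) (hk : s.nats 7 0 0 = k)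
    (he : s.nats 8 0 0 = e) :
    Reaches M.priceOracle insertUnit s 50 fun s' =>
      s'.nats = s.nats ∧ M.Stores δ B (addUnit x k e) s' := by
  refine Reaches.mono (Reaches.seq (T := 18) (T' := 14) (P := fun s' => s'.nats = s.nats ∧
    s'.reals = setCell s.reals 3 k e (x k e * δ + δ)) ?_ ?_) (by decide) fun _ h => h
  · refine (Reaches.setReal ⟨rfl, ?_⟩).mono (by decide) fun _ h => h
    simp [NatExp.eval, RealExp.eval, ownUnits, unitSize, hk, he, h.own, h.size]
  · rintro s1 ⟨h1, h1'⟩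
    have htot : s1.reals 4 e 0 = load n x e * δ := by
      rw [h1', setCell_array _ _ _ _ (by decide), h.total]
    have hsize : s1.reals 5 0 0 = δ := by
      rw [h1', setCell_array _ _ _ _ (by decide), h.size]
    refine (Reaches.setReal ⟨h1, ?_⟩).mono (by decide) fun _ h => h
    simp only [NatExp.eval, RealExp.eval, totalUnits, unitSize, h1, he, htot, hsize]
    constructor <;> simp only
    · exact h.firms
    · exact h.markets
    · exact h.access
    · exact h.units
    · intro k'
      rw [setCell_array _ _ _ _ (by decide), h1', setCell_array _ _ _ _ (by decide), h.cost]
    · intro k' e'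
      rw [setCell_array _ _ _ _ (by decide), h1']
      by_cases hc : k' = k ∧ e' = e
      · simp [setCell, addUnit, hc, add_mul]
      · simp [setCell, addUnit, hc, h.own]
    · intro e'
      rw [load_addUnit hkn]
      by_cases hc : e' = e
      · simp [setCell, hc, add_mul]
      · simp [setCell, hc, h1', h.total]
    · rw [setCell_array _ _ _ _ (by decide), hsize]

theorem Stores.removeUnit (h : M.Stores δ B (addUnit w k e) s) (hkn : k < n)
    (hk : s.nats 7 0 0 = k) (he : s.nats 9 0 0 = e) :
    Reaches M.priceOracle removeUnit s 50 fun s' => s'.nats = s.nats ∧ M.Stores δ B w s' := by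
  refine Reaches.mono (Reaches.seq (T := 18) (T' := 14) (P := fun s' => s'.nats = s.nats ∧
    s'.reals = setCell s.reals 3 k e (w k e * δ)) ?_ ?_) (by decide) fun _ h => h
  · refine (Reaches.setReal ⟨rfl, ?_⟩).mono (by decide) fun _ h => h
    simp [NatExp.eval, RealExp.eval, ownUnits, unitSize, hk, he, h.own, h.size, addUnit_self,
      add_mul]
  · rintro s1 ⟨h1, h1'⟩
    have htot : s1.reals 4 e 0 = load n w e * δ + δ := by
      rw [h1', setCell_array _ _ _ _ (by decide), h.total, load_addUnit hkn]
      simp [add_mul]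
    have hsize : s1.reals 5 0 0 = δ := by
      rw [h1', setCell_array _ _ _ _ (by decide), h.size]
    refine (Reaches.setReal ⟨h1, ?_⟩).mono (by decide) fun _ h => h
    simp only [NatExp.eval, RealExp.eval, totalUnits, unitSize, h1, he, htot, hsize,
      add_sub_cancel_right]
    constructor <;> simp only
    · exact h.firms
    · exact h.markets
    · exact h.access
    · exact h.units
    · intro k'
      rw [setCell_array _ _ _ _ (by decide), h1', setCell_array _ _ _ _ (by decide), h.cost]
    · intro k' e'
      rw [setCell_array _ _ _ _ (by decide), h1']
      by_cases hc : k' = k ∧ e' = e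
      · simp [setCell, hc]
      · have := h.own k' e'
        simp only [addUnit, hc, if_false, add_zero] at this
        simp [setCell, hc, this]
    · intro e'
      by_cases hc : e' = e
      · simp [setCell, hc]
      · have := h.total e'
        rw [load_addUnit hkn] at this
        simpa [setCell, hc, h1'] using this
    · rw [setCell_array _ _ _ _ (by decide), hsize]

end Oligopoly

/-! ### Termination and correctness of the insertion phases -/

namespace Oligopoly

open Finset UnitGame RealRAM

variable {n m : ℕ} {M : Oligopoly n m} {δ : ℝ} {B : ℕ} {x w : ℕ → ℕ → ℕ} {s s' : Store} {k e : ℕ}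

variable (M) in
/-- All units belong to firms and lie on resources of their owners, and firm `k` has `N k` units. -/
structure Allocates (N : ℕ → ℕ) (x : ℕ → ℕ → ℕ) : Prop where
  supported : ∀ k e, 0 < x k e → k < n ∧ e ∈ M.resources k
  total : ∀ k < n, ∑ e ∈ range (m + 1), x k e = N k

theorem le_of_mem_resources (h : e ∈ M.resources k) : e ≤ m := by
  rcases M.mem_resources.1 h with rfl | ⟨_, he, _⟩
  · exact le_rfl
  · exact he.le

theorem Allocates.addUnit {N : ℕ → ℕ} (h : M.Allocates N w) (hk : k < n)
    (he : e ∈ M.resources k) :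
    M.Allocates (fun k' => N k' + if k' = k then 1 else 0) (addUnit w k e) where
  supported k' e' hpos := by
    by_cases hc : k' = k ∧ e' = e
    · rw [hc.1, hc.2]
      exact ⟨hk, he⟩
    · exact h.supported k' e' (by simpa [UnitGame.addUnit, hc] using hpos)
  total k' hk' := by rw [sum_addUnit (le_of_mem_resources he), h.total k' hk']

theorem Allocates.of_addUnit {N : ℕ → ℕ} (h : M.Allocates N (UnitGame.addUnit w k e))
    (he : e ∈ M.resources k) :
    M.Allocates (fun k' => N k' - if k' = k then 1 else 0) w where
  supported k' e' hpos := h.supported k' e' (hpos.trans_le (le_addUnit _ _ _ _ _))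
  total k' hk' := by
    rw [← h.total k' hk', sum_addUnit (le_of_mem_resources he), Nat.add_sub_cancel]

/-- The unit that firm `k` would lose by leaving `f` is at least as good as any further unit. -/
def Stays (M : Oligopoly n m) (δ : ℝ) (B : ℕ) (ℓ : ℕ → ℕ) (x : ℕ → ℕ → ℕ) (f k : ℕ) : Prop :=
  0 < x k f → ∀ g ∈ M.resources k,
    M.gain δ B k g (load n x g) (x k g) ≤ M.gain δ B k f (ℓ f) (x k f - 1)

/-- The loop invariant of `settle`: compared to the loads `ℓ`, for which `x` is settled, there is
one more unit on `f`, and the firms before `κ` want to stay on `f`. -/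
structure Settling (M : Oligopoly n m) (δ : ℝ) (B : ℕ) (ℓ N : ℕ → ℕ) (x : ℕ → ℕ → ℕ) (f κ : ℕ)
    (s : Store) : Prop where
  stores : M.Stores δ B x s
  allocates : M.Allocates N x
  load_eq : ∀ e, load n x e = ℓ e + if e = f then 1 else 0
  settled : Settled M.resources (M.gain δ B) ℓ x
  hot : s.nats 9 0 0 = f
  hot_le : f ≤ m
  firm : s.nats 7 0 0 = κ
  firm_le : κ ≤ n
  stays : ∀ k < κ, M.Stays δ B ℓ x f k

/-- Either every firm was found to stay on `f`, or `f` is the resource `m`, whose gains ignore the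
load; in both cases `Settled.raise` applies. -/
theorem Settling.finish (hδ : 0 ≤ δ) {ℓ N : ℕ → ℕ} {f κ : ℕ}
    (h : M.Settling δ B ℓ N x f κ s) (hdone : κ < n → f = m) :
    Settled M.resources (M.gain δ B) (load n x) x := by
  refine h.settled.raise (M.gain_anti hδ B) h.load_eq ?_
  intro k hf hpos g hg
  by_cases hk : k < κ
  · exact h.stays k hk hpos g hg
  · obtain rfl := hdone (lt_of_le_of_lt (not_lt.1 hk) (h.allocates.supported k f hpos).1)
    refine (M.gain_anti hδ B k g hg (ℓ g) _ _ _ (by rw [h.load_eq]; omega) le_rfl).trans ?_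
    rw [M.gain_resource_last _ _ _ (ℓ f) (ℓ f - 1)]
    exact h.settled k f hf hpos g hg

/-- The bound for the number of iterations of `settle`. -/
noncomputable def settleRank (M : Oligopoly n m) (δ : ℝ) (B : ℕ) (ℓ : ℕ → ℕ) (x : ℕ → ℕ → ℕ)
    (κ : ℕ) : ℕ :=
  (n * (B * ((m + 1) * B)) - potential n m B (M.gain δ B) ℓ x) * (n + 1) + (n - κ)

/-- `settleRank` is lexicographic: a shift raises the potential, which outweighs restarting the scan
at firm 0, and a firm that stays advances the scan. -/
theorem Settling.step (hδ : 0 < δ) {ℓ N : ℕ → ℕ} (hN : ∀ k < n, N k ≤ B) {f κ : ℕ}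
    (h : M.Settling δ B ℓ N x f κ s) (hκ : κ < n) (hf : f < m) :
    Reaches M.priceOracle (.seq bestResource (.branch
      (.and (.realLe unitSize (ownUnits (natVar 9)))
        (realLt (marketLoss (natVar 9)) (realVar 6)))
      (.seq removeUnit (.seq insertUnit (.seq (assignNat 9 (natVar 8)) (assignNat 7 (.const 0)))))
      (assignNat 7 (.add (natVar 7) (.const 1))))) s (600 * (m + 1)) fun s' =>
        s'.nats 5 = s.nats 5 ∧ s'.nats 10 = s.nats 10 ∧ ∃ x' f' κ',
          settleRank M δ B ℓ x' κ' < settleRank M δ B ℓ x κ ∧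
            M.Settling δ B ℓ N x' f' κ' s' := by
  refine ((h.stores.bestResource h.firm).seq (T' := 200) ?_).mono (by omega) fun _ h => h
  rintro s1 ⟨hn1, hr1, g, hg, hg8, hg6, hmax⟩
  have hs1 : M.Stores δ B x s1 := h.stores.congr (fun a ha => hn1 a (by omega) (by omega)) hr1
  have hκ1 : s1.nats 7 0 0 = κ := by rw [hn1 _ (by decide) (by decide), h.firm]
  have hf1 : s1.nats 9 0 0 = f := by rw [hn1 _ (by decide) (by decide), h.hot]
  have hown : δ ≤ x κ f * δ ↔ 0 < x κ f := by
    rw [le_mul_iff_one_le_left hδ]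
    exact Nat.one_le_cast
  refine (Reaches.branch (T := 120) (fun hb => ?_) (fun hb => ?_)).mono (by decide) fun _ h => h
  · simp only [Test.Holds, unitSize, ownUnits, NatExp.eval, RealExp.eval, hs1.size, hs1.own, hκ1,
      hf1, hown, hg6, not_le] at hb
    obtain ⟨hpos, hlt⟩ := hb
    have hfR := (h.allocates.supported κ f hpos).2
    obtain ⟨w, rfl⟩ := exists_eq_addUnit hpos
    rw [hs1.eval_marketLoss hκ1 (by simpa [NatExp.eval]) hf hκ] at hlt
    have hload : load n w = ℓ := by
      funext e
      have := h.load_eq e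
      rw [load_addUnit hκ] at this
      omega
    -- Returning to `f` never beats staying there, so a strict improvement has another target.
    have hgf : g ≠ f := by
      rintro rfl
      exact absurd hlt (not_lt.2 (M.gain_anti hδ.le B κ g hg _ _ _ _
        (by simp [load_addUnit hκ]) (le_addUnit _ _ _ _ _)))
    have hsame : ∀ e, e ≠ f → M.gain δ B κ e (load n (addUnit w κ f) e) (addUnit w κ f κ e) =
        M.gain δ B κ e (ℓ e) (w κ e) := by
      intro e he
      rw [addUnit_of_ne_right _ _ _ he, h.load_eq, if_neg he, add_zero]
    rw [hsame g hgf, hload] at hlt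
    have hw : Settled M.resources (M.gain δ B) ℓ w :=
      Settled.of_addUnit (M.gain_anti hδ.le B) h.settled hfR hg hgf hlt
    -- The best resource was computed before the removal. Off `f` the gains are the same after it,
    -- and on `f` the gain is the loss, which `g` beats.
    have hbest : ∀ e ∈ M.resources κ,
        M.gain δ B κ e (ℓ e) (w κ e) ≤ M.gain δ B κ g (ℓ g) (w κ g) := by
      intro e he
      by_cases hef : e = f
      · rw [hef]
        exact hlt.le
      · rw [← hsame e hef, ← hsame g hgf]
        exact hmax e he
    have hgm := le_of_mem_resources hg
    have hxB : ∀ k < n, ∑ e ∈ range (m + 1), addUnit w κ g k e ≤ B := by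
      intro k hk
      rw [sum_addUnit hgm, ← sum_addUnit hf.le, h.allocates.total k hk]
      exact hN k hk
    have hwB : w κ f < B := by
      have h1 := h.allocates.total κ hκ
      have h2 : addUnit w κ f κ f ≤ ∑ e ∈ range (m + 1), addUnit w κ f κ e :=
        single_le_sum (f := fun e => addUnit w κ f κ e) (fun _ _ => Nat.zero_le _)
          (mem_range.2 (by omega))
      rw [addUnit_self] at h2
      have := hN κ hκ
      omega
    refine ((hs1.removeUnit hκ hκ1 hf1).seq (T' := 70) ?_).mono (by decide) fun _ h => h
    rintro s2 ⟨hn2, hs2⟩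
    refine ((hs2.insertUnit (e := g) hκ (by rw [hn2, hκ1]) (by rw [hn2, hg8])).seq
      (T' := 20) ?_).mono (by decide) fun _ h => h
    rintro s3 ⟨hn3, hs3⟩
    have h8 : s3.nats 8 0 0 = g := by rw [hn3, hn2, hg8]
    refine Reaches.mono (Reaches.seq (T := 10) (T' := 10) (P := fun s' =>
      s'.nats = setCell s3.nats 9 0 0 g ∧ s'.reals = s3.reals) ?_ ?_) (by decide) fun _ h => h
    · exact (Reaches.setNat ⟨by simp [NatExp.eval, h8], rfl⟩).mono (by decide) fun _ h => h
    rintro s4 ⟨hn4, hr4⟩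
    refine (Reaches.setNat ⟨?_, ?_, addUnit w κ g, g, 0, ?_, ?_⟩).mono (by decide) fun _ h => h
    · simp only
      rw [setCell_array _ _ _ _ (by decide), hn4, setCell_array _ _ _ _ (by decide), hn3, hn2,
        hn1 _ (by decide) (by decide)]
    · simp only
      rw [setCell_array _ _ _ _ (by decide), hn4, setCell_array _ _ _ _ (by decide), hn3, hn2,
        hn1 _ (by decide) (by decide)]
    · have h1 := potential_addUnit (h := M.gain δ B) (ℓ := ℓ) (w := w) B hκ hf.le
      have h2 := potential_addUnit (h := M.gain δ B) (ℓ := ℓ) (w := w) B hκ hgm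
      have h3 := rank_lt (h := M.gain δ B) (ℓ := ℓ) (k := κ) hf.le hwB hlt
      have h4 := potential_le (h := M.gain δ B) (ℓ := ℓ) hxB
      unfold settleRank
      have h5 : n * (B * ((m + 1) * B)) - potential n m B (M.gain δ B) ℓ (addUnit w κ g) + 1 ≤
          n * (B * ((m + 1) * B)) - potential n m B (M.gain δ B) ℓ (addUnit w κ f) := by omega
      have h6 := Nat.mul_le_mul_right (n + 1) h5
      rw [add_mul] at h6
      omega
    · constructor
      · refine hs3.congr (fun a ha => ?_) fun a _ => ?_
        · simp only
          rw [setCell_array _ _ _ _ (by omega), hn4, setCell_array _ _ _ _ (by omega)]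
        · simp only
          rw [hr4]
      · refine ⟨(Allocates.addUnit (h.allocates.of_addUnit hfR) hκ hg).supported, fun k hk => ?_⟩
        rw [sum_addUnit hgm, ← sum_addUnit hf.le, h.allocates.total k hk]
      · intro e
        rw [load_addUnit hκ, hload]
      · exact hw.addUnit (M.gain_anti hδ.le B) hg hbest
      · simp only
        rw [setCell_array _ _ _ _ (by decide), hn4, setCell_same]
      · exact hgm
      · simp [NatExp.eval, setCell_same]
      · exact Nat.zero_le _
      · intro k hk
        omega
  · simp only [Test.Holds, unitSize, ownUnits, NatExp.eval, RealExp.eval, hs1.size, hs1.own, hκ1,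
      hf1, hown, hg6, not_le, not_and, not_lt] at hb
    have heval : (NatExp.add (natVar 7) (.const 1)).eval s1 = κ + 1 := by simp [NatExp.eval, hκ1]
    refine (Reaches.setNat ⟨?_, ?_, x, f, κ + 1, ?_, ?_⟩).mono (by decide) fun _ h => h
    · simp only
      rw [setCell_array _ _ _ _ (by decide), hn1 _ (by decide) (by decide)]
    · simp only
      rw [setCell_array _ _ _ _ (by decide), hn1 _ (by decide) (by decide)]
    · unfold settleRank
      omega
    · constructor
      · refine hs1.congr (fun a ha => ?_) fun a _ => rfl
        simp only
        rw [setCell_array _ _ _ _ (by omega)]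
      · exact h.allocates
      · exact h.load_eq
      · exact h.settled
      · simp only
        rw [setCell_array _ _ _ _ (by decide), hf1]
      · exact h.hot_le
      · simp only [heval]
        rw [NatExp.eval, setCell_same]
      · exact hκ
      · intro k hk hpos e he
        rcases Nat.lt_succ_iff_lt_or_eq.1 hk with h' | rfl
        · exact h.stays k h' hpos e he
        · have h1 := hb hpos
          obtain ⟨w, rfl⟩ := exists_eq_addUnit hpos
          rw [hs1.eval_marketLoss hκ1 (by simpa [NatExp.eval]) hf hκ] at h1
          have hload : load n w f = ℓ f := by
            have := h.load_eq f
            rw [load_addUnit hκ] at this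
            omega
          rw [hload] at h1
          rw [addUnit_self, Nat.add_sub_cancel]
          exact (hmax e he).trans h1

/-- A bound for the number of steps of `settle`. -/
def settleTime (n m B : ℕ) : ℕ :=
  ((n * (B * ((m + 1) * B))) * (n + 1) + n) * (50 + 600 * (m + 1)) + 50

theorem Settling.settle (hδ : 0 < δ) {ℓ N : ℕ → ℕ} (hN : ∀ k < n, N k ≤ B) {f : ℕ}
    (h : M.Settling δ B ℓ N x f 0 s) :
    Reaches M.priceOracle settle s (settleTime n m B) fun s' =>
      s'.nats 5 = s.nats 5 ∧ s'.nats 10 = s.nats 10 ∧ ∃ x', M.Stores δ B x' s' ∧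
        M.Allocates N x' ∧ Settled M.resources (M.gain δ B) (load n x') x' := by
  refine (Reaches.loop (T := 600 * (m + 1)) (fun r s' => s'.nats 5 = s.nats 5 ∧
    s'.nats 10 = s.nats 10 ∧ ∃ x' f' κ', settleRank M δ B ℓ x' κ' ≤ r ∧
      M.Settling δ B ℓ N x' f' κ' s') ?_
      (r := settleRank M δ B ℓ x 0) ⟨rfl, rfl, x, f, 0, le_rfl, h⟩).mono ?_ ?_
  · rintro r s' ⟨h5, h10, x', f', κ', hr, h'⟩ hb
    simp only [Test.Holds, NatExp.eval, h'.firm, h'.hot, h'.stores.firms, h'.stores.markets,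
      not_le] at hb
    refine (h'.step hδ hN hb.1 hb.2).mono le_rfl ?_
    rintro s'' ⟨h5', h10', x'', f'', κ'', hr', h''⟩
    exact ⟨_, hr'.trans_le hr, h5'.trans h5, h10'.trans h10, x'', f'', κ'', le_rfl, h''⟩
  · unfold settleTime
    have : settleRank M δ B ℓ x 0 ≤ (n * (B * ((m + 1) * B))) * (n + 1) + n := by
      unfold settleRank
      gcongr
      · exact Nat.sub_le _ _
      · exact Nat.sub_le _ _
    gcongr
    · decide
    · decide
  · rintro s' ⟨⟨r, h5, h10, x', f', κ', -, h'⟩, hb⟩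
    simp only [Test.Holds, NatExp.eval, h'.firm, h'.hot, h'.stores.firms, h'.stores.markets,
      not_le, not_and, not_lt] at hb
    exact ⟨h5, h10, x', h'.stores, h'.allocates,
      h'.finish hδ.le fun hlt => le_antisymm h'.hot_le (hb hlt)⟩

/-- A bound for the number of steps of `unitPhase`. -/
def phaseTime (n m B : ℕ) : ℕ := settleTime n m B + 300 * (m + 1) + 100

theorem Stores.unitPhase (hδ : 0 < δ) {N : ℕ → ℕ} (h : M.Stores δ B x s)
    (hx : M.Allocates N x) (hset : Settled M.resources (M.gain δ B) (load n x) x)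
    (hk : s.nats 5 0 0 = k) (hkn : k < n) (hN : ∀ k' < n, N k' + (if k' = k then 1 else 0) ≤ B) :
    Reaches M.priceOracle unitPhase s (phaseTime n m B) fun s' =>
      s'.nats 5 = s.nats 5 ∧ s'.nats 10 = s.nats 10 ∧ ∃ x', M.Stores δ B x' s' ∧
        M.Allocates (fun k' => N k' + if k' = k then 1 else 0) x' ∧
        Settled M.resources (M.gain δ B) (load n x') x' := by
  refine Reaches.mono (Reaches.seq (T := 10) (T' := 300 * (m + 1) + (50 + (10 + (10 +
    settleTime n m B)))) (P := fun s' => s'.nats = setCell s.nats 7 0 0 k ∧ s'.reals = s.reals)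
    ?_ ?_) (by unfold phaseTime; omega) fun _ h => h
  · exact (Reaches.setNat ⟨by simp [NatExp.eval, hk], rfl⟩).mono (by decide) fun _ h => h
  rintro s1 ⟨hn1, hr1⟩
  have hs1 : M.Stores δ B x s1 := h.congr
    (fun a ha => by rw [hn1, setCell_array _ _ _ _ (by omega)]) (fun a _ => by rw [hr1])
  refine (hs1.bestResource (k := k) (by rw [hn1, setCell_same])).seq ?_
  rintro s2 ⟨hn2, hr2, g, hg, hg8, -, hmax⟩
  have hs2 : M.Stores δ B x s2 := hs1.congr (fun a ha => hn2 a (by omega) (by omega)) hr2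
  have h7 : s2.nats 7 0 0 = k := by rw [hn2 _ (by decide) (by decide), hn1, setCell_same]
  refine (hs2.insertUnit hkn h7 hg8).seq ?_
  rintro s3 ⟨hn3, hs3⟩
  refine Reaches.seq (T := 10) (P := fun s' => s'.nats = setCell s3.nats 9 0 0 g ∧
    s'.reals = s3.reals) ?_ ?_
  · exact (Reaches.setNat ⟨by simp [NatExp.eval, hn3, hg8], rfl⟩).mono (by decide) fun _ h => h
  rintro s4 ⟨hn4, hr4⟩
  refine Reaches.seq (T := 10) (P := fun s' => s'.nats = setCell s4.nats 7 0 0 0 ∧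
    s'.reals = s4.reals) ?_ ?_
  · exact (Reaches.setNat ⟨by simp [NatExp.eval], rfl⟩).mono (by decide) fun _ h => h
  rintro s5 ⟨hn5, hr5⟩
  have hframe : ∀ a, a ≠ 6 → a ≠ 7 → a ≠ 8 → a ≠ 9 → s5.nats a = s.nats a := by
    intro a h6 h7 h8 h9
    rw [hn5, setCell_array _ _ _ _ h7, hn4, setCell_array _ _ _ _ h9, hn3, hn2 _ h6 h8, hn1,
      setCell_array _ _ _ _ h7]
  -- `ℓ` is frozen at the loads before the insertion.
  have hinv : M.Settling δ B (load n x) (fun k' => N k' + if k' = k then 1 else 0)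
      (addUnit x k g) g 0 s5 := by
    constructor
    · refine hs3.congr (fun a ha => ?_) fun a _ => by rw [hr5, hr4]
      rw [hn5, setCell_array _ _ _ _ (by omega), hn4, setCell_array _ _ _ _ (by omega)]
    · exact hx.addUnit hkn hg
    · exact load_addUnit hkn x g
    · exact hset.addUnit (M.gain_anti hδ.le B) hg hmax
    · rw [hn5, setCell_array _ _ _ _ (by decide), hn4, setCell_same]
    · exact le_of_mem_resources hg
    · rw [hn5, setCell_same]
    · exact Nat.zero_le _
    · intro k hk
      omega
  refine (hinv.settle hδ hN).mono le_rfl ?_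
  rintro s6 ⟨h5, h10, hx'⟩
  exact ⟨h5.trans (hframe _ (by decide) (by decide) (by decide) (by decide)),
    h10.trans (hframe _ (by decide) (by decide) (by decide) (by decide)), hx'⟩

theorem Stores.distribute (hδ : 0 < δ) (h : M.Stores δ B (fun _ _ => 0) s) :
    Reaches M.priceOracle distribute s (B * (n * (phaseTime n m B + 16) + 12 + 16) + 12) fun s' =>
      ∃ x, M.Stores δ B x s' ∧ M.Allocates (fun _ => B) x ∧
        Settled M.resources (M.gain δ B) (load n x) x := by
  refine Reaches.forLoop (by decide) (fun u s' => ∃ x, M.Stores δ B x s' ∧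
    M.Allocates (fun _ => u) x ∧ Settled M.resources (M.gain δ B) (load n x) x) h.units ?_ ?_
  · refine ⟨fun _ _ => 0, h.congr (fun a ha => ?_) fun a _ => rfl, ⟨?_, ?_⟩, ?_⟩
    · simp only
      rw [setCell_array _ _ _ _ (by omega)]
    · intro k e hpos
      exact absurd hpos (lt_irrefl _)
    · simp
    · intro k e _ hpos
      exact absurd hpos (lt_irrefl _)
  · rintro u hu s1 ⟨x, hs, ha, hset⟩ hu1
    -- Within round `u`, the firms before `i` already have their extra unit.
    refine (Reaches.forLoop (N := n) (T := phaseTime n m B) (by decide) (fun i s' =>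
      s'.nats 10 0 0 = u ∧ ∃ x, M.Stores δ B x s' ∧
      M.Allocates (fun k => u + if k < i then 1 else 0) x ∧
      Settled M.resources (M.gain δ B) (load n x) x) hs.firms ?_ ?_).mono le_rfl ?_
    · refine ⟨?_, x, hs.congr (fun a ha => ?_) fun a _ => rfl, by simpa using ha, hset⟩
      · simp only
        rw [setCell_array _ _ _ _ (by decide), hu1]
      · simp only
        rw [setCell_array _ _ _ _ (by omega)]
    · rintro i hi s2 ⟨hu2, x2, hs2, ha2, hset2⟩ hi2
      refine (hs2.unitPhase hδ ha2 hset2 hi2 hi ?_).mono le_rfl ?_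
      · intro k' _
        split_ifs <;> omega
      · rintro s3 ⟨h5, h10, x3, hs3, ha3, hset3⟩
        refine ⟨by rw [h5, hi2], by rw [hs3.firms, hs2.firms], ?_, x3,
          hs3.congr (fun a ha => ?_) fun a _ => rfl, ⟨ha3.supported, fun k hk => ?_⟩, hset3⟩
        · simp only
          rw [setCell_array _ _ _ _ (by decide), h10, hu2]
        · simp only
          rw [setCell_array _ _ _ _ (by omega)]
        · rw [ha3.total k hk]
          split_ifs <;> omega
    · rintro s4 ⟨hu4, x4, hs4, ha4, hset4⟩
      refine ⟨hu4, by rw [hs4.units, hs.units], x4, hs4.congr (fun a ha => ?_) fun a _ => rfl,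
        ⟨ha4.supported, fun k hk => ?_⟩, hset4⟩
      · simp only
        rw [setCell_array _ _ _ _ (by omega)]
      · rw [ha4.total k hk, if_pos hk]

end Oligopoly

/-! ### Choice of the discretization and the whole algorithm -/

namespace RealRAM

/-- Increase the bound in variable 3 until the current firm has a negative price on the current
market, if it has access to it. -/
def raiseBound : Program :=
  .loop (.and (.natLe (.const 1) (.cell 2 (natVar 5) (natVar 6)))
      (.realLe (.cast (.const 0)) (.query (natVar 5) (natVar 6) (.cast (natVar 3)))))
    (assignNat 3 (.add (natVar 3) (.const 1)))

/-- Compute in variable 3 a quantity at which all prices are negative. -/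
def findBound : Program :=
  .seq (assignNat 3 (.const 1)) (forLoop 5 0 (forLoop 6 1 raiseBound))

/-- Compute the unit of production. -/
def setUnitSize : Program :=
  assignReal 5 (.div (realVar 2) (.mul (.cast (.add (natVar 1) (.const 1)))
    (.mul (realVar 1) (.cast (natVar 3)))))

/-- Compute the number of units per firm. -/
def countUnits : Program :=
  .loop (realLt (.mul (.cast (natVar 4)) unitSize) (.mul (.cast (natVar 1)) (.cast (natVar 3))))
    (assignNat 4 (.add (natVar 4) (.const 1)))

/-- The whole algorithm. -/
def computeEquilibrium : Program :=
  .seq findBound (.seq setUnitSize (.seq countUnits distribute))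

end RealRAM

namespace Oligopoly

open Finset UnitGame RealRAM

variable {n m : ℕ} {M : Oligopoly n m} {L ε : ℝ} {V W : ℕ} {s : Store}

/-- The store is the input except for some variables, and variable 3 holds a positive number up to
`V` at which the prices in `P` are negative. -/
structure Bounding (M : Oligopoly n m) (L ε : ℝ) (V : ℕ) (P : ℕ → ℕ → Prop) (s : Store) :
    Prop where
  frame : ∀ a, a ≠ 3 → a ≠ 5 → a ≠ 6 → s.nats a = (M.input L ε).nats a
  reals : s.reals = (M.input L ε).reals
  pos : 1 ≤ s.nats 3 0 0
  le : s.nats 3 0 0 ≤ V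
  neg : ∀ i, ∀ e ∈ M.access i, P i e → M.price i e (s.nats 3 0 0) < 0

theorem Bounding.setCell {P P' : ℕ → ℕ → Prop} (h : M.Bounding L ε V P s) {a v : ℕ}
    (ha : a = 5 ∨ a = 6) (hP : ∀ (i : Fin n) (e : Fin m), P' i e → P i e) :
    M.Bounding L ε V P' { s with nats := setCell s.nats a 0 0 v } := by
  have h3 : RealRAM.setCell s.nats a 0 0 v 3 = s.nats 3 := setCell_array _ _ _ _ (by omega)
  constructor
  · intro b hb3 hb5 hb6
    simp only
    rw [setCell_array _ _ _ _ (by omega), h.frame b hb3 hb5 hb6]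
  · exact h.reals
  · simpa only [h3] using h.pos
  · simpa only [h3] using h.le
  · intro i e he hp
    simpa only [h3] using h.neg i e he (hP i e hp)

/-- The bound only grows, so by monotonicity prices that are already negative stay negative. -/
theorem Bounding.raiseBound {P : ℕ → ℕ → Prop} (h : M.Bounding L ε V P s)
    (hV : ∀ i, ∀ e ∈ M.access i, ∀ t : ℕ, 0 ≤ M.price i e t → t + 1 ≤ V)
    {i e : ℕ} (hi : s.nats 5 0 0 = i) (he : s.nats 6 0 0 = e) :
    Reaches M.priceOracle raiseBound s (V * 60 + 50) fun s' =>
      s'.nats 5 = s.nats 5 ∧ s'.nats 6 = s.nats 6 ∧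
        M.Bounding L ε V (fun i' e' => P i' e' ∨ i' = i ∧ e' = e) s' := by
  refine (Reaches.loop (T := 12) (fun r s' => s'.nats 5 = s.nats 5 ∧ s'.nats 6 = s.nats 6 ∧
    V - s'.nats 3 0 0 ≤ r ∧ M.Bounding L ε V P s') ?_ (r := V) ⟨rfl, rfl, by omega, h⟩).mono ?_ ?_
  · rintro r s1 ⟨h5, h6, hr, h1⟩ ⟨hb1, hb2⟩
    simp only [Test.Holds, NatExp.eval, RealExp.eval, h5, h6, hi, he, Nat.cast_zero,
      h1.frame 2 (by decide) (by decide) (by decide), one_le_input_access] at hb1 hb2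
    obtain ⟨hem, hmem⟩ := hb1
    obtain hc | ⟨hin, _, hacc⟩ := M.mem_resources.1 hmem
    · omega
    have hO := M.priceOracle_of_mem hacc
    simp only at hO
    rw [hO] at hb2
    have hlt := hV _ _ hacc _ hb2
    have h3 : RealRAM.setCell s1.nats 3 0 0 (s1.nats 3 0 0 + 1) 3 0 0 = s1.nats 3 0 0 + 1 :=
      setCell_same _ _ _ _ _
    refine (Reaches.setNat ⟨r - 1, ?_, ?_, ?_, ?_, ?_⟩).mono (by decide) fun _ h => h
    · omega
    · simp only
      rw [setCell_array _ _ _ _ (by decide), h5]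
    · simp only
      rw [setCell_array _ _ _ _ (by decide), h6]
    · simp only [NatExp.eval, h3]
      omega
    · constructor
      · intro a ha3 ha5 ha6
        simp only
        rw [setCell_array _ _ _ _ ha3, h1.frame a ha3 ha5 ha6]
      · exact h1.reals
      · simp only [NatExp.eval, h3]
        omega
      · simpa only [NatExp.eval, h3] using hlt
      · intro i' e' he' hp
        simp only [NatExp.eval, h3]
        refine (M.price_antitone i' e' he' ?_).trans_lt (h1.neg i' e' he' hp)
        push_cast
        linarith
  · gcongr <;> decide
  · rintro s1 ⟨⟨r, h5, h6, hr, h1⟩, hb⟩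
    refine ⟨h5, h6, h1.frame, h1.reals, h1.pos, h1.le, ?_⟩
    rintro i' e' he' (hp | ⟨rfl, rfl⟩)
    · exact h1.neg i' e' he' hp
    · simp only [Test.Holds, NatExp.eval, RealExp.eval, h5, h6, hi, he, Nat.cast_zero,
        h1.frame 2 (by decide) (by decide) (by decide), one_le_input_access, not_and, not_le] at hb
      have := hb ⟨e'.2, M.mem_resources.2 (Or.inr ⟨i'.2, e'.2, he'⟩)⟩
      rwa [M.priceOracle_of_mem he'] at this

theorem findBound_reaches (hV1 : 1 ≤ V)
    (hV : ∀ i, ∀ e ∈ M.access i, ∀ t : ℕ, 0 ≤ M.price i e t → t + 1 ≤ V) :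
    Reaches M.priceOracle findBound (M.input L ε)
      (10 + (n * (m * (V * 60 + 50 + 16) + 12 + 16) + 12))
      (M.Bounding L ε V fun _ _ => True) := by
  refine Reaches.seq (P := M.Bounding L ε V fun _ _ => False) ?_ ?_
  · refine (Reaches.setNat ?_).mono (by decide) fun _ h => h
    constructor
    · intro a ha3 _ _
      simp only
      rw [setCell_array _ _ _ _ ha3]
    · rfl
    · simp [NatExp.eval, RealRAM.setCell]
    · simpa [NatExp.eval, RealRAM.setCell] using hV1
    · exact fun _ _ _ h => h.elim
  · intro s1 h1
    refine (Reaches.forLoop (N := n) (T := m * (V * 60 + 50 + 16) + 12) (by decide)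
      (fun i => M.Bounding L ε V fun i' _ => i' < i) ?_ ?_ ?_).mono le_rfl ?_
    · rw [h1.frame 0 (by decide) (by decide) (by decide)]
      simp [input]
    · exact h1.setCell (Or.inl rfl) fun i e h => absurd h (Nat.not_lt_zero _)
    · intro i hi s2 h2 hi2
      refine (Reaches.forLoop (N := m) (T := V * 60 + 50) (by decide)
        (fun e s' => s'.nats 5 0 0 = i ∧
          M.Bounding L ε V (fun i' e' => i' < i ∨ i' = i ∧ e' < e) s') ?_ ?_ ?_).mono le_rfl ?_
      · rw [h2.frame 1 (by decide) (by decide) (by decide)]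
        simp [input]
      · refine ⟨?_, h2.setCell (Or.inr rfl) fun i e h => by omega⟩
        simp only
        rw [setCell_array _ _ _ _ (by decide), hi2]
      · rintro e he s3 ⟨hi3, h3⟩ he3
        refine (h3.raiseBound hV hi3 he3).mono le_rfl ?_
        rintro s4 ⟨h5, h6, h4⟩
        refine ⟨by rw [h6, he3], ?_, ?_, h4.setCell (Or.inr rfl) fun i e h => by omega⟩
        · rw [h4.frame 1 (by decide) (by decide) (by decide),
            h3.frame 1 (by decide) (by decide) (by decide)]
        · simp only
          rw [setCell_array _ _ _ _ (by decide), h5, hi3]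
      · rintro s3 ⟨hi3, h3⟩
        refine ⟨hi3, ?_, h3.setCell (Or.inl rfl) fun i e h => ?_⟩
        · rw [h3.frame 0 (by decide) (by decide) (by decide),
            h2.frame 0 (by decide) (by decide) (by decide)]
        · have := e.2
          omega
    · exact fun s2 h2 => ⟨h2.frame, h2.reals, h2.pos, h2.le, fun i e he _ => h2.neg i e he i.2⟩

/-- The machine has no rounding, so `B` is found by counting; `W` already meets the exit condition,
which bounds the search. -/
theorem countUnits_reaches {δ : ℝ} {U : ℕ} (h : M.Stores δ 0 (fun _ _ => 0) s)
    (hU : s.nats 3 0 0 = U) (hδ : 0 ≤ δ) (hW : (m : ℝ) * U ≤ W * δ) :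
    Reaches M.priceOracle countUnits s (W * 50 + 30) fun s' =>
      ∃ B ≤ W, (m : ℝ) * U ≤ B * δ ∧ M.Stores δ B (fun _ _ => 0) s' := by
  refine (Reaches.loop (T := 12) (fun r s' => s'.nats 3 0 0 = U ∧ ∃ B ≤ W, W - B ≤ r ∧
    M.Stores δ B (fun _ _ => 0) s') ?_ (r := W) ⟨hU, 0, Nat.zero_le _, by omega, h⟩).mono ?_ ?_
  · rintro r s1 ⟨h3, B, hB, hr, h1⟩ hb
    simp only [Test.Holds, NatExp.eval, RealExp.eval, unitSize, h1.units, h1.size, h1.markets,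
      h3, not_le] at hb
    have hlt : B < W := by
      by_contra! hc
      have : (W : ℝ) * δ ≤ B * δ := by gcongr
      linarith
    refine (Reaches.setNat ⟨r - 1, by omega, ?_, B + 1, hlt, by omega, ?_⟩).mono (by decide)
      fun _ h => h
    · simp only
      rw [setCell_array _ _ _ _ (by decide), h3]
    · constructor <;> simp only
      · rw [setCell_array _ _ _ _ (by decide), h1.firms]
      · rw [setCell_array _ _ _ _ (by decide), h1.markets]
      · rw [setCell_array _ _ _ _ (by decide), h1.access]
      · simp [NatExp.eval, RealRAM.setCell, h1.units]
      · exact h1.cost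
      · exact h1.own
      · exact h1.total
      · exact h1.size
  · gcongr <;> decide
  · rintro s1 ⟨⟨r, h3, B, hB, hr, h1⟩, hb⟩
    simp only [Test.Holds, NatExp.eval, RealExp.eval, unitSize, h1.units, h1.size, h1.markets,
      h3, not_not] at hb
    exact ⟨B, hB, hb, h1⟩

/-- A bound for the number of steps of `computeEquilibrium`. -/
def totalTime (n m V W : ℕ) : ℕ :=
  10 + (n * (m * (V * 60 + 50 + 16) + 12 + 16) + 12) + (30 + (W * 50 + 30 +
    (W * (n * (phaseTime n m W + 16) + 12 + 16) + 12)))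

theorem phaseTime_mono {B : ℕ} (h : B ≤ W) : phaseTime n m B ≤ phaseTime n m W := by
  unfold phaseTime settleTime
  gcongr

theorem computeEquilibrium_reaches {L : ℝ≥0} {ε : ℝ} (hL0 : 0 < L) (hε : 0 < ε)
    (hL : ∀ i, ∀ e ∈ M.access i, LipschitzWith L (M.price i e))
    (hz : ∀ i, ∀ e ∈ M.access i, ∃ z : ℝ, 0 ≤ z ∧ IsGreatest {t : ℝ | M.price i e t = 0} z)
    (hV1 : 1 ≤ V) (hV : ∀ i, ∀ e ∈ M.access i, ∀ t : ℕ, 0 ≤ M.price i e t → t + 1 ≤ V)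
    (hW : (m : ℝ) * V * ((m + 1) * (L * V)) / ε ≤ W) :
    Reaches M.priceOracle computeEquilibrium (M.input L ε) (totalTime n m V W) fun s =>
      M.IsApproxEquilibrium ε (output n m s) := by
  refine (findBound_reaches hV1 hV).seq ?_
  intro s1 h1
  obtain ⟨U, hU⟩ : ∃ U, s1.nats 3 0 0 = U := ⟨_, rfl⟩
  have hU1 : 1 ≤ U := hU ▸ h1.pos
  have hUV : U ≤ V := hU ▸ h1.le
  have hL0' : (0 : ℝ) < L := hL0
  have hU0 : (0 : ℝ) < U := by exact_mod_cast hU1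
  -- The factor `m + 1` instead of `m` avoids division by zero when there are no markets.
  obtain ⟨δ, hδdef⟩ : ∃ δ : ℝ, δ = ε / ((m + 1) * (L * U)) := ⟨_, rfl⟩
  have hδ : 0 < δ := by rw [hδdef]; positivity
  have hinput := fun a (h : a < 3) => h1.frame a (by omega) (by omega) (by omega)
  refine Reaches.seq (T := 30) (P := fun s' => s'.nats 3 0 0 = U ∧
    M.Stores δ 0 (fun _ _ => 0) s') ?_ ?_
  · refine (Reaches.setReal ⟨hU, ?_⟩).mono (by decide) fun _ h => h
    constructor <;> simp only
    · simp [hinput, input]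
    · simp [hinput, input]
    · rw [hinput 2 (by decide)]
      rfl
    · rw [h1.frame 4 (by decide) (by decide) (by decide)]
      simp [input]
    · intro k
      rw [setCell_array _ _ _ _ (by decide), h1.reals]
      simp [input, costCoeff]
    · intro k e
      rw [setCell_array _ _ _ _ (by decide), h1.reals]
      simp [input]
    · intro e
      rw [setCell_array _ _ _ _ (by decide), h1.reals]
      simp [input, load]
    · simp only [NatExp.eval, RealExp.eval, setCell_same, hU, h1.reals, hinput 1 (by decide)]
      simp [input, hδdef]
  rintro s2 ⟨hU2, h2⟩
  have hWδ : (m : ℝ) * U ≤ W * δ := by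
    have hUV' : (U : ℝ) ≤ V := by exact_mod_cast hUV
    calc (m : ℝ) * U = m * U * ((m + 1) * (L * U)) / ε * δ := by
          rw [hδdef]; field_simp
      _ ≤ m * V * ((m + 1) * (L * V)) / ε * δ := by gcongr
      _ ≤ W * δ := by gcongr
  refine (countUnits_reaches h2 hU2 hδ.le hWδ).seq ?_
  rintro s3 ⟨B, hBW, hB, h3⟩
  refine (h3.distribute hδ).mono ?_ ?_
  · have := phaseTime_mono (n := n) (m := m) hBW
    gcongr
  rintro s4 ⟨x, h4, hx, hset⟩
  have hout : output n m s4 = fun (i : Fin n) (e : Fin m) => (x i e * δ : ℝ) := by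
    funext i e
    exact h4.own i e
  rw [hout]
  refine M.isApproxEquilibrium_of_settled (L := L) (U := U) hδ hL ?_ hB ?_ hset
    (fun k e hpos => (hx.supported k e hpos).2) hx.total
  · intro i e he
    obtain ⟨z, hz0, hz⟩ := hz i e he
    refine ⟨z, hz0, ?_, hz⟩
    by_contra! hlt
    have hneg := h1.neg i e he trivial
    rw [hU] at hneg
    have := M.price_antitone i e he hlt.le
    rw [hz.1] at this
    linarith
  · calc (m : ℝ) * (δ * (L * U)) ≤ (m + 1) * (δ * (L * U)) := by gcongr; linarith
      _ = ε := by rw [hδdef]; field_simp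

/-- With `W ≤ N ^ 6`, the potential is at most `N ^ 14`; scanning the firms and their markets gives
order `N ^ 16` per phase, and there are at most `N ^ 7` phases. -/
theorem totalTime_le {N : ℕ} (hn : n + 1 ≤ N) (hm : m + 1 ≤ N) (hV : V ≤ N) (hW : W ≤ N ^ 6) :
    totalTime n m V W ≤ 4000 * N ^ 23 := by
  have hN : 1 ≤ N := by omega
  have hn' : n ≤ N := by omega
  have hm' : m ≤ N := by omega
  have hpow : ∀ {a b : ℕ}, a ≤ b → N ^ a ≤ N ^ b := fun h => Nat.pow_le_pow_right hN h
  have hsettle : settleTime n m W ≤ 1350 * N ^ 16 := by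
    calc settleTime n m W
        ≤ ((N * (N ^ 6 * (N * N ^ 6))) * N + N) * (50 + 600 * N) + 50 := by
          unfold settleTime; gcongr
      _ = 50 * N ^ 15 + 600 * N ^ 16 + 50 * N ^ 1 + 600 * N ^ 2 + 50 * N ^ 0 := by ring
      _ ≤ 50 * N ^ 16 + 600 * N ^ 16 + 50 * N ^ 16 + 600 * N ^ 16 + 50 * N ^ 16 := by
          gcongr <;> first | exact hN | decide
      _ = _ := by ring
  have hphase : phaseTime n m W ≤ 1750 * N ^ 16 := by
    calc phaseTime n m W ≤ 1350 * N ^ 16 + 300 * N + 100 := by unfold phaseTime; gcongr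
      _ = 1350 * N ^ 16 + 300 * N ^ 1 + 100 * N ^ 0 := by ring
      _ ≤ 1350 * N ^ 16 + 300 * N ^ 16 + 100 * N ^ 16 := by
          gcongr <;> first | exact hN | decide
      _ = _ := by ring
  calc totalTime n m V W
      ≤ 10 + (N * (N * (N * 60 + 50 + 16) + 12 + 16) + 12) + (30 + (N ^ 6 * 50 + 30 +
        (N ^ 6 * (N * (1750 * N ^ 16 + 16) + 12 + 16) + 12))) := by unfold totalTime; gcongr
    _ = 94 * N ^ 0 + 28 * N ^ 1 + 66 * N ^ 2 + 60 * N ^ 3 + 78 * N ^ 6 + 16 * N ^ 7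
        + 1750 * N ^ 23 := by ring
    _ ≤ 94 * N ^ 23 + 28 * N ^ 23 + 66 * N ^ 23 + 60 * N ^ 23 + 78 * N ^ 23 + 16 * N ^ 23
        + 1750 * N ^ 23 := by gcongr <;> first | exact hN | decide
    _ ≤ _ := by omega

/-- A nonnegative price at `t` puts `t` below the largest zero, one of the nonnegative summands of
`demand`. -/
theorem le_maxDemand
    (hz : ∀ i, ∀ e ∈ M.access i, ∃ z : ℝ, 0 ≤ z ∧ IsGreatest {t : ℝ | M.price i e t = 0} z)
    {i : Fin n} {e : Fin m} (he : e ∈ M.access i) {t : ℝ} (ht : 0 ≤ M.price i e t) :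
    t ≤ M.maxDemand := by
  have hsup : ∀ i, ∀ e ∈ M.access i, 0 ≤ sSup {t : ℝ | M.price i e t = 0} := by
    intro i e he
    obtain ⟨z, hz0, hz⟩ := hz i e he
    rwa [hz.csSup_eq]
  obtain ⟨z, hz0, hz⟩ := hz i e he
  have h1 : t ≤ z := by
    by_contra! hlt
    have h2 := M.price_antitone i e he hlt.le
    rw [hz.1] at h2
    exact absurd (hz.2 (le_antisymm h2 ht)) (not_le.2 hlt)
  calc t ≤ z := h1
    _ = sSup {t : ℝ | M.price i e t = 0} := hz.csSup_eq.symm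
    _ ≤ M.demand i := single_le_sum (f := fun e => sSup {t : ℝ | M.price i e t = 0}) (hsup i) he
    _ ≤ M.maxDemand := le_ciSup (f := M.demand) (Set.finite_range _).bddAbove i

theorem maxDemand_nonneg
    (hz : ∀ i, ∀ e ∈ M.access i, ∃ z : ℝ, 0 ≤ z ∧ IsGreatest {t : ℝ | M.price i e t = 0} z) :
    0 ≤ M.maxDemand := by
  refine Real.iSup_nonneg fun i => sum_nonneg fun e he => ?_
  obtain ⟨z, hz0, hz⟩ := hz i e he
  rwa [hz.csSup_eq]

end Oligopoly

/-- There is one program that computes an `ε`-approximate equilibrium of every multimarket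
oligopoly with `L`-Lipschitz price functions, in a number of steps that is polynomial in the number
of firms, the number of markets, and the values of `L`, `max_i d_i` and `1 / ε`. -/
theorem mainTheorem3 :
    ∃ (prog : RealRAM.Program) (K k : ℕ),
      ∀ (n m : ℕ) (M : Oligopoly n m) (L : ℝ≥0) (ε : ℝ),
        0 < L → 0 < ε →
        (∀ i, ∀ e ∈ M.access i, LipschitzWith L (M.price i e)) →
        (∀ i, ∀ e ∈ M.access i, ∃ z : ℝ, 0 ≤ z ∧ IsGreatest {t : ℝ | M.price i e t = 0} z) →
        ∃ (s : RealRAM.Store) (t : ℕ),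
          RealRAM.Runs M.priceOracle prog (M.input L ε) s t ∧
          (t : ℝ) ≤ K * (1 + n + m + L + M.maxDemand + 1 / ε) ^ k ∧
          M.IsApproxEquilibrium ε (Oligopoly.output n m s) := by
  refine ⟨RealRAM.computeEquilibrium, 4000, 23, fun n m M L ε hL0 hε hL hz => ?_⟩
  have hD := Oligopoly.maxDemand_nonneg hz
  have hε' : 0 < 1 / ε := by positivity
  have hn0 : (0 : ℝ) ≤ n := n.cast_nonneg
  have hm0 : (0 : ℝ) ≤ m := m.cast_nonneg
  have hL0' : (0 : ℝ) ≤ L := L.2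
  set S : ℝ := 1 + n + m + L + M.maxDemand + 1 / ε with hS
  have hSpos : 0 ≤ S := by linarith
  -- The summand 1 in `S` absorbs rounding up any one of the parameters.
  set N : ℕ := ⌊S⌋₊ with hN
  have hVle : ⌊M.maxDemand⌋₊ + 1 ≤ N := by
    refine Nat.le_floor ?_
    push_cast
    have := Nat.floor_le hD
    linarith
  have hLle : ⌈(L : ℝ)⌉₊ ≤ N := by
    refine Nat.le_floor ?_
    have := Nat.ceil_lt_add_one hL0'
    linarith
  have hεle : ⌈1 / ε⌉₊ ≤ N := by
    refine Nat.le_floor ?_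
    have := Nat.ceil_lt_add_one hε'.le
    linarith
  have hnle : n + 1 ≤ N := Nat.le_floor (by push_cast; linarith)
  have hmle : m + 1 ≤ N := Nat.le_floor (by push_cast; linarith)
  -- Six factors, each at most `N`: `m`, `V` twice, `m + 1`, `L` and `1 / ε`, where `V` is
  -- `⌊M.maxDemand⌋₊ + 1`.
  have hW : (m : ℝ) * (⌊M.maxDemand⌋₊ + 1 : ℕ) * ((m + 1) * (L * (⌊M.maxDemand⌋₊ + 1 : ℕ))) / ε
      ≤ (N ^ 6 : ℕ) := by
    have h1 : (m : ℝ) ≤ N := by exact_mod_cast (Nat.le_succ m).trans hmle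
    have h2 : (m : ℝ) + 1 ≤ N := by exact_mod_cast hmle
    have h3 : ((⌊M.maxDemand⌋₊ + 1 : ℕ) : ℝ) ≤ N := by exact_mod_cast hVle
    have h4 : (L : ℝ) ≤ N := (Nat.le_ceil _).trans (by exact_mod_cast hLle)
    have h5 : 1 / ε ≤ N := (Nat.le_ceil _).trans (by exact_mod_cast hεle)
    rw [div_eq_mul_one_div]
    calc _ ≤ (N : ℝ) * N * (N * (N * N)) * N := by gcongr
      _ = _ := by push_cast; ring
  obtain ⟨s, t, hrun, ht, hs⟩ := Oligopoly.computeEquilibrium_reaches (M := M) hL0 hε hL hz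
    (V := ⌊M.maxDemand⌋₊ + 1) (by omega)
    (fun i e he t ht => Nat.succ_le_succ (Nat.le_floor (Oligopoly.le_maxDemand hz he ht))) hW
  refine ⟨s, t, hrun, ?_, hs⟩
  calc (t : ℝ) ≤ (4000 * N ^ 23 : ℕ) := by
        exact_mod_cast ht.trans (Oligopoly.totalTime_le hnle hmle hVle le_rfl)
    _ = 4000 * (N : ℝ) ^ 23 := by push_cast; ring
    _ ≤ (4000 : ℕ) * S ^ 23 := by
        push_cast
        gcongr
        exact Nat.floor_le hSpos
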